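/- **Setting.** Let $L>0$, $N\ge 1$. In the unit cell $(0,L)$ there are $N$ resonators $D_i=(x_i^-,x_i^+)$, $i=1,\dots,N$, of length $\ell_i$, with $0\le x_1^-<x_1^+<x_2^-<\dots<x_N^+\le L$ and $x_N^+<x_1^-+L$; put $D_i^m=D_i+mL$ $(m\in\mathbb Z)$. The background is the complement of the closed resonators; its connected components are called gaps. We write $g|_\pm(x)=\lim_{h\downarrow0}g(x\pm h)$. For $\alpha\in Y^*=(-\pi/L,\pi/L]$ let $V_j^\alpha$ be the unique continuous function that is harmonic in the background, equals $\delta_{ij}$ on $D_i$, $i=1,\dots,N$, and satisfies $V_j^\alpha(x+mL)=e^{i\alpha mL}V_j^\alpha(x)$; the capacitance matrix is $$C^\alpha_{ij}=\frac{dV_j^\alpha}{dx}\Big|_-(x_i^-)-\frac{dV_j^\alpha}{dx}\Big|_+(x_i^+).$$ **Material.** Let $\kappa_0,\rho_0,\kappa_{\mathrm r},\rho_{\mathrm r}^{m,i},\delta^m>0$, $v_0=\sqrt{\kappa_0/\rho_0}$, $v_{\mathrm r}^{m,i}=\sqrt{\kappa_{\mathrm r}/\rho_{\mathrm r}^{m,i}}$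 (a spatial defect in $\rho$ across cells). Let $s_i,\kappa_i^p$ be nowhere vanishing real functions of time such that $1/s_i$ and $1/\kappa_i^p$ are trigonometric polynomials of frequency $\Omega>0$, and let $$\frac1{\kappa_i(t)}=\frac1{\kappa_i^p(t)}+c_if(t),\qquad c_i\in\mathbb R,\ f\in C^1(\mathbb R;\mathbb R),\ f(t)\to0\ (|t|\to\infty)$$ (a temporal defect in $\kappa$). For $\Lambda\in\mathbb R$ and a reference contrast $\delta\in(0,1]$ assume $1/v_0,\ 1/v_{\mathrm r}^{m,i},\ |s_i|,\ |1/s_i|,\ |1/\kappa_i|,\ |(1/\kappa_i)'|\le\Lambda$, $\ \delta^m\le\Lambda\delta$ and $\delta\le\Lambda\delta^m$. **Field.** Let $u(x,t)$ be complex-valued, $C^2$ in $(x,t)$ up to the boundary on each resonator and each gap (times $\mathbb R$), and let it satisfy, for all $m\in\mathbb Z$, $i=1,\dots,N$ and $t\in\mathbb R$, $$\partial_t^2u-v_0^2\,\partial_x^2u=0\ \text{ in the background},\qquad \partial_t\Big(\frac1{\kappa_i(t)}\partial_tu\Big)-(v_{\mathrm r}^{m,i})^2\,\partial_x^2u=0\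 \text{ in }D_i^m,$$ $$u|_\pm=\frac1{s_i(t)}u|_\mp,\qquad \delta^m\,\partial_xu|_\pm=\frac1{s_i(t)}\,\partial_xu|_\mp\qquad\text{at }x_i^\pm+mL.$$ Let $\gamma\in(0,1)$, $A\in\mathbb R$, and let $J\subset\mathbb R$ be an open set of times (for instance $J=\mathbb R$). Assume that on $J$ the field is localised and subwavelength: there is a summable sequence $(a_m)_{m\in\mathbb Z}$ with $\sum_ma_m\le A$ such that for $t\in J$ and $x\in[mL,(m+1)L)$ not a boundary point of a resonator, $$|u(x,t)|\le a_m,\qquad |\partial_tu(x,t)|\le a_m\,\delta^{(1-\gamma)/2},\qquad |\partial_t^2u(x,t)|\le a_m\,\delta^{(1-\gamma)/2}.$$ (For example, superpositions of waves $v(x,\omega)e^{i\omega t}$ over frequencies $|\omega|\lesssim\delta^{(1-\gamma)/2}$.) Let $u_i^m(t)=\frac1{\ell_i}\int_{D_i^m}u(x,t)\,dx$. **Proposition.** For every geometry, every $\alpha\in\mathbb R$ and every $j$, the function $V_j^\alpha$ exists and is unique. For every geometry and every $\Lambda$ there is a constant $C$, depending on nothing else, such that for all $\gamma,\delta$, material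 parameters, $u$, $A$, $J$ as above: 1. $|u(x,t)-u_i^m(t)|\le C\,A\,\delta^{(1-\gamma)/2}$ for all $m$, $i$, $x\in D_i^m$, $t\in J$. 2. For all $\alpha\in Y^*$, $i=1,\dots,N$ and $t\in J$, the Floquet–Bloch sums below converge absolutely, the derivatives below exist, and $$\left|\sum_{j=1}^N\frac1{s_j(t)}C^\alpha_{ij}\sum_{m\in\mathbb Z}u_j^m(t)e^{-i\alpha mL}+\frac{\ell_i}{\kappa_{\mathrm r}s_i(t)}\frac{d}{dt}\left(\Big(\frac1{\kappa_i^p(t)}+c_if(t)\Big)\frac{d}{dt}\sum_{m\in\mathbb Z}u_i^m(t)\frac{e^{-i\alpha mL}\rho_{\mathrm r}^{m,i}}{\delta^m}\right)\right|\le C\,A\,\delta^{(1-\gamma)/2}.$$ That is, as $\delta\to0$ the values $u_i^m$ satisfy at leading order, with error $O(\delta^{(1-\gamma)/2})$, the coupled ODE $$\sum_{j}\frac1{s_j}C^\alpha_{ij}\sum_{m}u_j^me^{-i\alpha mL}=-\frac{\ell_i}{\kappa_{\mathrm r}s_i}\frac{d}{dt}\left(\Big(\frac1{\kappa_i^p}+c_if\Big)\frac{d}{dt}\sum_{m}u_i^m\frac{e^{-i\alpha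 mL}\rho_{\mathrm r}^{m,i}}{\delta^m}\right).$$ -/

import Mathlib

open Filter Topology MeasureTheory

noncomputable section

namespace SpaceTimeDefect

/-- An infinite one-dimensional chain of resonators, periodic with period `L` and with `N`
resonators `(lo k, hi k)`, `k = 1, …, N`, in the unit cell `(0, L)`. The boundary points are
extended to all `k : ℤ` by `lo (k + N) = lo k + L`, `hi (k + N) = hi k + L`. -/
structure Geometry (N : ℕ) where
  L : ℝ
  L_pos : 0 < L
  lo : ℤ → ℝ
  hi : ℤ → ℝ
  lo_lt_hi : ∀ k, lo k < hi k
  hi_lt_lo : ∀ k, hi k < lo (k + 1)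
  lo_add : ∀ k, lo (k + N) = lo k + L
  hi_add : ∀ k, hi (k + N) = hi k + L
  lo_nonneg : 0 ≤ lo 1
  hi_le : hi N ≤ L

/-- Position in the chain of the `i`-th resonator of the `m`-th cell. The usual index
`1, …, N` of a resonator in its cell is `i + 1` for `i : Fin N`. -/
def idx {N : ℕ} (m : ℤ) (i : Fin N) : ℤ := m * N + (i + 1)

/-- The limit of `g` at `x` from the left, `g|₋(x)`. -/
def traceLeft (g : ℝ → ℂ) (x : ℝ) : ℂ := limUnder (𝓝[<] x) g

/-- The limit of `g` at `x` from the right, `g|₊(x)`. -/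
def traceRight (g : ℝ → ℂ) (x : ℝ) : ℂ := limUnder (𝓝[>] x) g

namespace Geometry

variable {N : ℕ} (G : Geometry N)

/-- The `k`-th resonator. -/
def resonator (k : ℤ) : Set ℝ := Set.Ioo (G.lo k) (G.hi k)

/-- The component of the background between the resonators `k` and `k + 1`. -/
def gap (k : ℤ) : Set ℝ := Set.Ioo (G.hi k) (G.lo (k + 1))

/-- The length `ℓ_i` of the `i`-th resonator. -/
def len (i : Fin N) : ℝ := G.hi (idx 0 i) - G.lo (idx 0 i)

/-- `V` is the function `V_j^α`: harmonic in the background, equal to `δ_{ij}` on the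
resonators of the unit cell, and `α`-quasiperiodic. -/
structure IsPotential (α : ℝ) (j : Fin N) (V : ℝ → ℂ) : Prop where
  continuous : Continuous V
  contDiffOn : ∀ k, ContDiffOn ℝ 2 V (G.gap k)
  harmonic : ∀ k, ∀ x ∈ G.gap k, iteratedDeriv 2 V x = 0
  on_resonator : ∀ i : Fin N, ∀ x ∈ G.resonator (idx 0 i), V x = if i = j then 1 else 0
  quasiperiodic : ∀ (m : ℤ) (x : ℝ),
    V (x + m * G.L) = Complex.exp (Complex.I * α * m * G.L) * V x

/-- `I_{∂D_i}[g] = g'|₋(x_i⁻) - g'|₊(x_i⁺)`. -/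
def boundaryFlux (i : Fin N) (g : ℝ → ℂ) : ℂ :=
  traceLeft (deriv g) (G.lo (idx 0 i)) - traceRight (deriv g) (G.hi (idx 0 i))

/-- The capacitance matrix `C_{ij} = I_{∂D_i}[V_j]` of a family of potentials. -/
def capacitance (V : Fin N → ℝ → ℂ) : Matrix (Fin N) (Fin N) ℂ :=
  fun i j => G.boundaryFlux i (V j)

/-- The value `u_i^m(t)` of the field in the `i`-th resonator of the `m`-th cell, normalised
as the mean of `u(·, t)` over that resonator. -/
def mode (u : ℝ → ℝ → ℂ) (m : ℤ) (i : Fin N) (t : ℝ) : ℂ :=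
  ((G.len i)⁻¹ : ℝ) * ∫ x in (G.lo (idx m i))..(G.hi (idx m i)), u x t

/-- The phase `e^{-iαmL}` of the `m`-th cell in the Floquet-Bloch sum. -/
def phase (α : ℝ) (m : ℤ) : ℂ := Complex.exp (-(Complex.I * α * m * G.L))

end Geometry

/-- Material parameters: background `κ₀, ρ₀`; interior parameters `κ_r κ_i(t)` and
`ρ_r^{m,i}` (a defect in space); contrasts `δ^m` of the cells; boundary sources `s_i(t)`;
`1/s_i` and `1/κ_i^p` are trigonometric polynomials of frequency `Ω`; and a decaying
`f` that yields the defect in time, `1/κ_i = 1/κ_i^p + c_i f`. -/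
structure Material (N : ℕ) where
  κ₀ : ℝ
  ρ₀ : ℝ
  κr : ℝ
  ρr : ℤ → Fin N → ℝ
  contrast : ℤ → ℝ
  κ₀_pos : 0 < κ₀
  ρ₀_pos : 0 < ρ₀
  κr_pos : 0 < κr
  ρr_pos : ∀ m i, 0 < ρr m i
  contrast_pos : ∀ m, 0 < contrast m
  Ω : ℝ
  Ω_pos : 0 < Ω
  M : ℕ
  s : Fin N → ℝ → ℝ
  κp : Fin N → ℝ → ℝ
  s_ne : ∀ i t, s i t ≠ 0
  κp_ne : ∀ i t, κp i t ≠ 0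
  sCoeff : Fin N → ℤ → ℂ
  kCoeff : Fin N → ℤ → ℂ
  s_fourier : ∀ i t, ((1 / s i t : ℝ) : ℂ) =
    ∑ n ∈ Finset.Icc (-(M : ℤ)) M, sCoeff i n * Complex.exp (Complex.I * n * Ω * t)
  κp_fourier : ∀ i t, ((1 / κp i t : ℝ) : ℂ) =
    ∑ n ∈ Finset.Icc (-(M : ℤ)) M, kCoeff i n * Complex.exp (Complex.I * n * Ω * t)
  c : Fin N → ℝ
  f : ℝ → ℝ
  f_contDiff : ContDiff ℝ 1 f
  f_decay : Tendsto f (cocompact ℝ) (𝓝 0)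

namespace Material

variable {N : ℕ} (P : Material N)

/-- `1/κ_i(t) = 1/κ_i^p(t) + c_i f(t)`. -/
def invκ (i : Fin N) (t : ℝ) : ℝ := 1 / P.κp i t + P.c i * P.f t

/-- The wave speed `v₀` of the background. -/
def v₀ : ℝ := √(P.κ₀ / P.ρ₀)

/-- The wave speed `v_r^{m,i}` in the `i`-th resonator of the `m`-th cell. -/
def vr (m : ℤ) (i : Fin N) : ℝ := √(P.κr / P.ρr m i)

/-- High contrast of order `δ`, all other normalised parameters being controlled by `Λ`. -/
structure HighContrast (Λ δ : ℝ) : Prop where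
  background : 1 / P.v₀ ≤ Λ
  inside : ∀ m i, 1 / P.vr m i ≤ Λ
  contrast_le : ∀ m, P.contrast m ≤ Λ * δ
  le_contrast : ∀ m, δ ≤ Λ * P.contrast m
  source_le : ∀ i t, |P.s i t| ≤ Λ
  inv_source_le : ∀ i t, |1 / P.s i t| ≤ Λ
  invκ_le : ∀ i t, |P.invκ i t| ≤ Λ
  deriv_invκ_le : ∀ i t, |deriv (P.invκ i) t| ≤ Λ

/-- `u` is a classical solution of the transmission problem, twice continuously
differentiable up to the boundary on every resonator and every gap. -/
structure IsSolution (G : Geometry N) (u : ℝ → ℝ → ℂ) : Prop where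
  regular_resonator : ∀ k, ∃ U : ℝ × ℝ → ℂ, ContDiff ℝ 2 U ∧
    ∀ x ∈ G.resonator k, ∀ t, u x t = U (x, t)
  regular_gap : ∀ k, ∃ U : ℝ × ℝ → ℂ, ContDiff ℝ 2 U ∧
    ∀ x ∈ G.gap k, ∀ t, u x t = U (x, t)
  wave_gap : ∀ k, ∀ x ∈ G.gap k, ∀ t,
    iteratedDeriv 2 (fun τ => u x τ) t
      - (P.v₀ ^ 2 : ℝ) * iteratedDeriv 2 (fun y => u y t) x = 0
  wave_resonator : ∀ m i, ∀ x ∈ G.resonator (idx m i), ∀ t,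
    deriv (fun τ => (P.invκ i τ : ℂ) * deriv (fun τ' => u x τ') τ) t
      - (P.vr m i ^ 2 : ℝ) * iteratedDeriv 2 (fun y => u y t) x = 0
  value_lo : ∀ m i t, traceLeft (fun y => u y t) (G.lo (idx m i)) =
    (1 / P.s i t : ℝ) * traceRight (fun y => u y t) (G.lo (idx m i))
  value_hi : ∀ m i t, traceRight (fun y => u y t) (G.hi (idx m i)) =
    (1 / P.s i t : ℝ) * traceLeft (fun y => u y t) (G.hi (idx m i))
  flux_lo : ∀ m i t,
    (P.contrast m : ℂ) * traceLeft (deriv fun y => u y t) (G.lo (idx m i)) =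
      (1 / P.s i t : ℝ) * traceRight (deriv fun y => u y t) (G.lo (idx m i))
  flux_hi : ∀ m i t,
    (P.contrast m : ℂ) * traceRight (deriv fun y => u y t) (G.hi (idx m i)) =
      (1 / P.s i t : ℝ) * traceLeft (deriv fun y => u y t) (G.hi (idx m i))

/-- The weighted Floquet-Bloch sum `∑_m u_i^m(t) e^{-iαmL} ρ_r^{m,i} / δ^m`. -/
def weightedBloch (G : Geometry N) (u : ℝ → ℝ → ℂ) (α : ℝ) (i : Fin N) (t : ℝ) : ℂ :=
  ∑' m : ℤ, G.mode u m i t * (G.phase α m * (P.ρr m i / P.contrast m : ℝ))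

/-- `(1/κ_i^p + c_i f) d/dt ∑_m u_i^m e^{-iαmL} ρ_r^{m,i} / δ^m`. -/
def momentum (G : Geometry N) (u : ℝ → ℝ → ℂ) (α : ℝ) (i : Fin N) (t : ℝ) : ℂ :=
  ((1 / P.κp i t + P.c i * P.f t : ℝ) : ℂ) * deriv (P.weightedBloch G u α i) t

end Material

/-- For times in `J`, the field `u` is localised in space, with size at most `a m` in the
`m`-th cell and `∑ a m ≤ A`, and lies in the subwavelength (low-frequency) regime: its first
two time derivatives are of relative size `δ^{(1-γ)/2}`. By the next lemma this covers
superpositions of time-harmonic waves `v(x, ω) e^{iωt}` concentrated on frequencies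
of order `δ^{(1-γ)/2}`. -/
def IsLocalisedSubwavelength {N : ℕ} (G : Geometry N) (δ γ A : ℝ) (J : Set ℝ)
    (u : ℝ → ℝ → ℂ) : Prop :=
  ∃ a : ℤ → ℝ, Summable a ∧ ∑' m, a m ≤ A ∧
    ∀ (m : ℤ) (x : ℝ), x ∈ Set.Ico (m * G.L) ((m + 1) * G.L) →
      (∃ k, x ∈ G.resonator k ∪ G.gap k) → ∀ t ∈ J,
        ‖u x t‖ ≤ a m ∧
        ‖deriv (fun τ => u x τ) t‖ ≤ a m * δ ^ ((1 - γ) / 2) ∧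
        ‖iteratedDeriv 2 (fun τ => u x τ) t‖ ≤ a m * δ ^ ((1 - γ) / 2)

lemma hasDerivAt_fourier (μ : Measure ℝ) (w : ℝ → ℂ) (hw : Integrable w μ)
    (hw' : Integrable (fun ω : ℝ => (ω : ℂ) * w ω) μ) (t : ℝ) :
    HasDerivAt (fun τ : ℝ => ∫ ω, w ω * Complex.exp (Complex.I * ω * τ) ∂μ)
      (∫ ω, (Complex.I * (ω * w ω)) * Complex.exp (Complex.I * ω * t) ∂μ) t := by
  have hn : ∀ ω τ : ℝ, ‖Complex.exp (Complex.I * ω * τ)‖ = 1 := fun ω τ => by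
    rw [show Complex.I * ω * τ = ((ω * τ : ℝ) : ℂ) * Complex.I by push_cast; ring]
    exact Complex.norm_exp_ofReal_mul_I _
  have he : ∀ τ : ℝ, AEStronglyMeasurable (fun ω : ℝ => Complex.exp (Complex.I * ω * τ)) μ :=
    fun τ => (by fun_prop : Continuous fun ω : ℝ =>
      Complex.exp (Complex.I * ω * τ)).aestronglyMeasurable
  refine (hasDerivAt_integral_of_dominated_loc_of_deriv_le (𝕜 := ℝ)
    (F := fun (τ : ℝ) (ω : ℝ) => w ω * Complex.exp (Complex.I * ω * τ))
    (F' := fun (τ : ℝ) (ω : ℝ) => (Complex.I * (ω * w ω)) * Complex.exp (Complex.I * ω * τ))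
    (bound := fun ω : ℝ => ‖(ω : ℂ) * w ω‖) (s := Set.univ) univ_mem ?_ ?_ ?_ ?_ hw'.norm ?_).2
  · exact Eventually.of_forall fun τ => hw.aestronglyMeasurable.mul (he τ)
  · refine hw.mono (hw.aestronglyMeasurable.mul (he t)) (Eventually.of_forall fun ω => ?_)
    simp only [norm_mul, hn, mul_one, le_refl]
  · exact (hw'.aestronglyMeasurable.const_mul _).mul (he t)
  · refine Eventually.of_forall fun ω τ _ => ?_
    simp only [norm_mul, hn, Complex.norm_I, one_mul, mul_one, le_refl]
  · refine Eventually.of_forall fun ω τ _ => ?_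
    have h : HasDerivAt (fun τ : ℝ => Complex.I * (ω : ℂ) * (τ : ℂ)) (Complex.I * ω) τ := by
      simpa using ((hasDerivAt_id τ).ofReal_comp).const_mul (Complex.I * (ω : ℂ))
    exact (h.cexp.const_mul (w ω)).congr_deriv (by ring)

/-- A field `u(x, t) = ∫ v(x, ω) e^{iωt} dμ(ω)` whose frequency content is concentrated on
frequencies of order `δ^{(1-γ)/2}` is localised and subwavelength. Lebesgue measure gives
Fourier integrals, counting measure on `ω₀ + Ω ℤ` gives Floquet series. -/
lemma IsLocalisedSubwavelength.of_fourier {N : ℕ} (G : Geometry N) (δ γ A : ℝ) (J : Set ℝ)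
    (u v : ℝ → ℝ → ℂ) (μ : Measure ℝ) (a : ℤ → ℝ) (ha : Summable a) (hA : ∑' m, a m ≤ A)
    (hu : ∀ x t, u x t = ∫ ω, v x ω * Complex.exp (Complex.I * ω * t) ∂μ)
    (h0 : ∀ x, Integrable (v x) μ) (h1 : ∀ x, Integrable (fun ω : ℝ => (ω : ℂ) * v x ω) μ)
    (h2 : ∀ x, Integrable (fun ω : ℝ => (ω : ℂ) * (ω * v x ω)) μ)
    (hb : ∀ (m : ℤ) (x : ℝ), x ∈ Set.Ico (m * G.L) ((m + 1) * G.L) →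
      ∫ ω, ‖v x ω‖ ∂μ ≤ a m ∧
      ∫ ω : ℝ, |ω| * ‖v x ω‖ ∂μ ≤ a m * δ ^ ((1 - γ) / 2) ∧
      ∫ ω : ℝ, ω ^ 2 * ‖v x ω‖ ∂μ ≤ a m * δ ^ ((1 - γ) / 2)) :
    IsLocalisedSubwavelength G δ γ A J u := by
  have hn : ∀ ω τ : ℝ, ‖Complex.exp (Complex.I * ω * τ)‖ = 1 := fun ω τ => by
    rw [show Complex.I * ω * τ = ((ω * τ : ℝ) : ℂ) * Complex.I by push_cast; ring]
    exact Complex.norm_exp_ofReal_mul_I _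
  refine ⟨a, ha, hA, fun m x hx _ t _ => ?_⟩
  obtain ⟨b0, b1, b2⟩ := hb m x hx
  have e0 : (fun τ => u x τ) = fun τ : ℝ => ∫ ω, v x ω * Complex.exp (Complex.I * ω * τ) ∂μ :=
    funext fun τ => hu x τ
  have e1 : deriv (fun τ => u x τ) =
      fun τ : ℝ => ∫ ω, (Complex.I * (ω * v x ω)) * Complex.exp (Complex.I * ω * τ) ∂μ := by
    rw [e0]; exact funext fun τ => (hasDerivAt_fourier μ _ (h0 x) (h1 x) τ).deriv
  have e2 : iteratedDeriv 2 (fun τ => u x τ) t =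
      ∫ ω, (Complex.I * (ω * (Complex.I * (ω * v x ω)))) *
        Complex.exp (Complex.I * ω * t) ∂μ := by
    rw [iteratedDeriv_succ, iteratedDeriv_one, e1]
    refine (hasDerivAt_fourier μ _ ((h1 x).const_mul _) ?_ t).deriv
    refine ((h2 x).const_mul Complex.I).congr (Eventually.of_forall fun ω => ?_)
    simp only []
    ring
  refine ⟨?_, ?_, ?_⟩
  · rw [hu x t]
    refine (norm_integral_le_integral_norm _).trans (le_trans (le_of_eq ?_) b0)
    simp only [norm_mul, hn, mul_one]
  · rw [e1]
    refine (norm_integral_le_integral_norm _).trans (le_trans (le_of_eq ?_) b1)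
    simp only [norm_mul, hn, mul_one, Complex.norm_I, one_mul, Complex.norm_real,
      Real.norm_eq_abs]
  · rw [e2]
    refine (norm_integral_le_integral_norm _).trans (le_trans (le_of_eq ?_) b2)
    congr 1
    funext ω
    simp only [norm_mul, hn, mul_one, Complex.norm_I, one_mul, Complex.norm_real,
      Real.norm_eq_abs]
    rw [← mul_assoc, abs_mul_abs_self, sq]

end SpaceTimeDefect

end

/-!
The problem is one-dimensional, so everything reduces to Taylor estimates on intervals.

*Potentials.* A function harmonic in a gap is affine there (`eq_affine_of_iteratedDeriv_two_eq_zero`),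
so `V_j^α` has to be the continuous interpolation, affine in the gaps, of its values `e^{iαmL} δ_{ij}`
on the resonators. This gives existence and uniqueness and shows that the capacitance matrix is the
difference of two slopes of this interpolation (`IsPotential.boundaryFlux_eq`).

*One time.* Write `d = δ^{(1-γ)/2}`, so that `δ ≤ d ≤ 1`. By the wave equations the bounds on the
time derivatives bound `∂_x² u` by `O(d)` in gaps and resonators. In a gap `u` is bounded, hence so
is `∂_x u`; the transmission condition makes `∂_x u` of size `O(δ)` at the boundary inside a
resonator, hence of size `O(d)` throughout it. So `u` is constant up to `O(d)` on each resonator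
(`Snapshot.norm_sub_mean_le`). The boundary values of `u` in the gaps are therefore `u_k / s_k` up to
`O(d)`, and the exterior slopes at a resonator are those of the affine interpolation of `u_k / s_k`.
The other transmission condition expresses these exterior slopes by the interior fluxes
(`Snapshot.norm_slopeJump_sub_le`).

*Time evolution.* The wave equation integrated over a resonator equates the interior flux with the
derivative of the momentum of the mean (`Extension.momentum_balance`). The Floquet-Bloch transform of
the slope differences is the capacitance matrix applied to the Bloch sums (`hasSum_capacitance`);
that of the momentum balance is the derivative of the momentum, because the bounds on the time
derivatives allow termwise differentiation (`Extension.hasDerivAt_momentum`). The errors in the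
cells are summable, with sum `O(A d)`.
-/

namespace SpaceTimeDefect

/-! ### Indexing of the chain -/

namespace Geometry

variable {N : ℕ} (G : Geometry N)

lemma N_pos {N : ℕ} (G : Geometry N) : 0 < N := by
  rcases Nat.eq_zero_or_pos N with rfl | h
  · have h1 := G.lo_add 0
    have h2 := G.L_pos
    simp only [Nat.cast_zero, add_zero] at h1
    linarith
  · exact h

lemma lo_strictMono : StrictMono G.lo :=
  strictMono_int_of_lt_succ fun k => (G.lo_lt_hi k).trans (G.hi_lt_lo k)

lemma lo_add_mul (m k : ℤ) : G.lo (k + m * N) = G.lo k + m * G.L := by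
  induction m using Int.induction_on with
  | zero => simp
  | succ n ih =>
    have h := G.lo_add (k + n * N)
    rw [show k + ((n : ℤ) + 1) * N = k + n * N + N by ring, h, ih]
    push_cast; ring
  | pred n ih =>
    have h := G.lo_add (k + (-(n : ℤ) - 1) * N)
    rw [show k + (-(n : ℤ) - 1) * N + N = k + -(n : ℤ) * N by ring, ih] at h
    push_cast at h ⊢; linarith

lemma hi_add_mul (m k : ℤ) : G.hi (k + m * N) = G.hi k + m * G.L := by
  induction m using Int.induction_on with
  | zero => simp
  | succ n ih =>
    have h := G.hi_add (k + n * N)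
    rw [show k + ((n : ℤ) + 1) * N = k + n * N + N by ring, h, ih]
    push_cast; ring
  | pred n ih =>
    have h := G.hi_add (k + (-(n : ℤ) - 1) * N)
    rw [show k + (-(n : ℤ) - 1) * N + N = k + -(n : ℤ) * N by ring, ih] at h
    push_cast at h ⊢; linarith

/-- Length of the gap between the resonators `k` and `k + 1`. -/
def gapLen (k : ℤ) : ℝ := G.lo (k + 1) - G.hi k

/-- Length of the `k`-th resonator of the chain. -/
def resLen (k : ℤ) : ℝ := G.hi k - G.lo k

lemma gapLen_pos (k : ℤ) : 0 < G.gapLen k := sub_pos.2 (G.hi_lt_lo k)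

lemma resLen_pos (k : ℤ) : 0 < G.resLen k := sub_pos.2 (G.lo_lt_hi k)

lemma gapLen_add_mul (m k : ℤ) : G.gapLen (k + m * N) = G.gapLen k := by
  unfold gapLen
  rw [show k + m * N + 1 = k + 1 + m * N by ring, G.lo_add_mul, G.hi_add_mul]; ring

lemma resLen_add_mul (m k : ℤ) : G.resLen (k + m * N) = G.resLen k := by
  unfold resLen
  rw [G.lo_add_mul, G.hi_add_mul]; ring

/-- The cell that contains the `k`-th resonator. -/
def cellOf (_ : Geometry N) (k : ℤ) : ℤ := (k - 1) / N

/-- The number of the `k`-th resonator within its cell. -/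
def posOf (k : ℤ) : Fin N :=
  ⟨((k - 1) % N).toNat, by
    have h := Int.emod_lt_of_pos (k - 1) (Int.natCast_pos.2 G.N_pos)
    have := Int.emod_nonneg (k - 1) (Int.natCast_pos.2 G.N_pos).ne'
    omega⟩

lemma idx_cellOf_posOf (k : ℤ) : idx (G.cellOf k) (G.posOf k) = k := by
  have h := Int.emod_nonneg (k - 1) (Int.natCast_pos.2 G.N_pos).ne'
  have h2 := Int.mul_ediv_add_emod (k - 1) N
  simp only [idx, cellOf, posOf, Int.toNat_of_nonneg h]
  linarith

lemma cellOf_idx (m : ℤ) (i : Fin N) : G.cellOf (idx m i) = m := by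
  have hN : (N : ℤ) ≠ 0 := (Int.natCast_pos.2 G.N_pos).ne'
  simp only [idx, cellOf]
  rw [show m * (N : ℤ) + ((i : ℕ) + 1) - 1 = (i : ℕ) + m * N by ring,
    Int.add_mul_ediv_right _ _ hN, Int.ediv_eq_zero_of_lt (by positivity) (by exact_mod_cast i.2),
    zero_add]

lemma posOf_idx (m : ℤ) (i : Fin N) : G.posOf (idx m i) = i := by
  apply Fin.ext
  simp only [idx, posOf]
  rw [show m * (N : ℤ) + ((i : ℕ) + 1) - 1 = (i : ℕ) + m * N by ring,
    Int.add_mul_emod_self_right, Int.emod_eq_of_lt (by positivity) (by exact_mod_cast i.2)]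
  simp

lemma idx_add_mul (n m : ℤ) (i : Fin N) : idx m i + n * N = idx (m + n) i := by
  simp only [idx]; ring

lemma cellOf_add_mul (n k : ℤ) : G.cellOf (k + n * N) = G.cellOf k + n := by
  conv_lhs => rw [← G.idx_cellOf_posOf k, idx_add_mul, G.cellOf_idx]

lemma posOf_add_mul (n k : ℤ) : G.posOf (k + n * N) = G.posOf k := by
  conv_lhs => rw [← G.idx_cellOf_posOf k, idx_add_mul, G.posOf_idx]

lemma len_eq (m : ℤ) (i : Fin N) : G.len i = G.resLen (idx m i) := by
  have h : idx m i = idx 0 i + m * N := by rw [idx_add_mul, zero_add]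
  rw [h, G.resLen_add_mul]; rfl

/-- One constant controls all lengths of the chain and the inverse gap lengths. -/
lemma exists_length_bound :
    ∃ B : ℝ, ∀ k, G.gapLen k ≤ B ∧ (G.gapLen k)⁻¹ ≤ B ∧ G.resLen k ≤ B := by
  refine ⟨∑ i : Fin N, (G.gapLen (idx 0 i) + (G.gapLen (idx 0 i))⁻¹ + G.resLen (idx 0 i)),
    fun k => ?_⟩
  have h : k = idx 0 (G.posOf k) + G.cellOf k * N := by
    rw [idx_add_mul, zero_add, G.idx_cellOf_posOf]
  have h1 : G.gapLen k = G.gapLen (idx 0 (G.posOf k)) := by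
    conv_lhs => rw [h, G.gapLen_add_mul]
  have h2 : G.resLen k = G.resLen (idx 0 (G.posOf k)) := by
    conv_lhs => rw [h, G.resLen_add_mul]
  have h3 := Finset.single_le_sum (s := Finset.univ) (f := fun i : Fin N =>
    G.gapLen (idx 0 i) + (G.gapLen (idx 0 i))⁻¹ + G.resLen (idx 0 i)) (fun i _ => by
      have := G.gapLen_pos (idx 0 i)
      have := G.resLen_pos (idx 0 i)
      positivity) (Finset.mem_univ (G.posOf k))
  simp only [← h1, ← h2] at h3
  have h4 := G.gapLen_pos k
  have h5 := G.resLen_pos k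
  have h6 := inv_pos.2 h4
  refine ⟨?_, ?_, ?_⟩ <;> linarith

/-- The half-open intervals `[lo k, lo (k + 1))` cover the line. -/
lemma exists_mem_Ico (x : ℝ) : ∃ k, x ∈ Set.Ico (G.lo k) (G.lo (k + 1)) := by
  obtain ⟨n, hn⟩ : ∃ n : ℤ, G.lo (1 + n * N) ≤ x ∧ x < G.lo (1 + (n + 1) * N) := by
    have hL := G.L_pos
    refine ⟨⌊(x - G.lo 1) / G.L⌋, ?_, ?_⟩
    · rw [G.lo_add_mul]
      have := (le_div_iff₀ hL).1 (Int.floor_le ((x - G.lo 1) / G.L))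
      linarith
    · rw [G.lo_add_mul]
      have := (div_lt_iff₀ hL).1 (Int.lt_floor_add_one ((x - G.lo 1) / G.L))
      push_cast
      linarith
  obtain ⟨k, hk, hmax⟩ := Int.exists_greatest_of_bdd (P := fun k => G.lo k ≤ x)
    ⟨1 + (n + 1) * N, fun z hz => (G.lo_strictMono.lt_iff_lt.1 (hz.trans_lt hn.2)).le⟩
    ⟨_, hn.1⟩
  refine ⟨k, hk, lt_of_not_ge fun h => ?_⟩
  have := hmax _ h
  omega

lemma eq_of_mem_Ico {x : ℝ} {j k : ℤ} (hj : x ∈ Set.Ico (G.lo j) (G.lo (j + 1)))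
    (hk : x ∈ Set.Ico (G.lo k) (G.lo (k + 1))) : j = k := by
  have h1 := G.lo_strictMono.lt_iff_lt.1 (hj.1.trans_lt hk.2)
  have h2 := G.lo_strictMono.lt_iff_lt.1 (hk.1.trans_lt hj.2)
  omega

/-- The pieces of the chain next to a resonator of the cell `m` lie within distance two of that
cell. -/
lemma abs_sub_le_of_mem {m : ℤ} {i : Fin N} {j n : ℤ} {x : ℝ}
    (hj : |j - idx m i| ≤ 1) (hx : x ∈ Set.Ico (G.lo j) (G.lo (j + 1)))
    (hn : x ∈ Set.Ico (n * G.L) ((n + 1) * G.L)) : |n - m| ≤ 2 := by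
  have hL := G.L_pos
  have hN : (1 : ℤ) ≤ N := by exact_mod_cast G.N_pos
  have hi : ((i : ℕ) : ℤ) + 1 ≤ N := by exact_mod_cast i.2
  have hi0 : (0 : ℤ) ≤ ((i : ℕ) : ℤ) := by positivity
  rw [abs_le] at hj
  simp only [idx] at hj
  have h1 : G.lo (1 + (m - 1) * N) ≤ G.lo j := G.lo_strictMono.monotone (by linarith)
  have h2 : G.lo (j + 1) ≤ G.lo (1 + (m + 2) * N) := G.lo_strictMono.monotone (by linarith)
  rw [G.lo_add_mul] at h1 h2
  push_cast at h1 h2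
  have h3 : G.lo 1 < G.L := by
    have h4 : G.lo 1 ≤ G.lo N := G.lo_strictMono.monotone hN
    have := G.lo_lt_hi N
    linarith [G.hi_le]
  have h0 := G.lo_nonneg
  have h5 : ((m - 1 : ℤ) : ℝ) * G.L < ((n + 1 : ℤ) : ℝ) * G.L := by
    push_cast; linarith [hx.1, hn.2]
  have h6 : (n : ℝ) * G.L < ((m + 3 : ℤ) : ℝ) * G.L := by
    push_cast; linarith [hx.2, hn.1]
  have h7 := lt_of_mul_lt_mul_right h5 hL.le
  have h8 := lt_of_mul_lt_mul_right h6 hL.le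
  norm_cast at h7 h8
  rw [abs_le]; constructor <;> omega

/-- The last resonator of a cell lies in that cell. -/
lemma resonator_subset_cell (n : ℤ) :
    G.resonator (N + n * N) ⊆ Set.Ico (n * G.L) ((n + 1) * G.L) := by
  intro x hx
  have h1 : G.lo 1 ≤ G.lo N := G.lo_strictMono.monotone (by exact_mod_cast G.N_pos)
  rw [resonator, G.lo_add_mul, G.hi_add_mul] at hx
  exact ⟨by linarith [hx.1, G.lo_nonneg], by linarith [hx.2, G.hi_le]⟩

end Geometry

/-! ### One-sided traces and calculus on an interval -/

lemma traceLeft_eq {g φ : ℝ → ℂ} {p x : ℝ} (hpx : p < x)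
    (h : ∀ y ∈ Set.Ioo p x, g y = φ y) (hφ : ContinuousAt φ x) : traceLeft g x = φ x := by
  refine Filter.Tendsto.limUnder_eq ((hφ.tendsto.mono_left nhdsWithin_le_nhds).congr' ?_)
  filter_upwards [Ioo_mem_nhdsLT hpx] with y hy using (h y hy).symm

lemma traceRight_eq {g φ : ℝ → ℂ} {x q : ℝ} (hxq : x < q)
    (h : ∀ y ∈ Set.Ioo x q, g y = φ y) (hφ : ContinuousAt φ x) : traceRight g x = φ x := by
  refine Filter.Tendsto.limUnder_eq ((hφ.tendsto.mono_left nhdsWithin_le_nhds).congr' ?_)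
  filter_upwards [Ioo_mem_nhdsGT hxq] with y hy using (h y hy).symm

lemma deriv_eq_of_eqOn_Ioo {g φ : ℝ → ℂ} {p q : ℝ} (h : ∀ y ∈ Set.Ioo p q, g y = φ y) :
    ∀ y ∈ Set.Ioo p q, deriv g y = deriv φ y := fun _ hy =>
  Filter.EventuallyEq.deriv_eq (Filter.eventuallyEq_of_mem (isOpen_Ioo.mem_nhds hy) h)

lemma iteratedDeriv_two (φ : ℝ → ℂ) : iteratedDeriv 2 φ = deriv (deriv φ) := by
  rw [iteratedDeriv_succ, iteratedDeriv_one]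

/-- A function with vanishing second derivative on an interval, continuous up to the end points,
is the affine interpolation of its boundary values. -/
lemma eq_affine_of_iteratedDeriv_two_eq_zero {V : ℝ → ℂ} {p q : ℝ} (hpq : p < q)
    (hc : ContinuousOn V (Set.Icc p q)) (hd : ContDiffOn ℝ 2 V (Set.Ioo p q))
    (h0 : ∀ x ∈ Set.Ioo p q, iteratedDeriv 2 V x = 0) :
    ∀ x ∈ Set.Icc p q, V x = V p + (V q - V p) * (((x - p) / (q - p) : ℝ) : ℂ) := by
  have hd1 : DifferentiableOn ℝ V (Set.Ioo p q) := hd.differentiableOn (by norm_num)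
  have hd2 : DifferentiableOn ℝ (deriv V) (Set.Ioo p q) :=
    (((contDiffOn_succ_iff_deriv_of_isOpen (n := 1) isOpen_Ioo).1
      (by simpa [one_add_one_eq_two] using hd)).2.2).differentiableOn (by norm_num)
  obtain ⟨c, hcst⟩ := isOpen_Ioo.exists_is_const_of_deriv_eq_zero isPreconnected_Ioo hd2
    (fun x hx => by simpa [iteratedDeriv_two] using h0 x hx)
  have hlin : ∀ x : ℝ, HasDerivAt (fun x : ℝ => (x : ℂ) * c) c x := fun x => by
    simpa using (Complex.ofRealCLM.hasDerivAt (x := x)).mul_const c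
  obtain ⟨w, hw⟩ := isOpen_Ioo.exists_is_const_of_deriv_eq_zero
    (f := fun x : ℝ => V x - x * c) isPreconnected_Ioo
    (fun x hx => (hd1 x hx).sub (hlin x).differentiableAt.differentiableWithinAt)
    (fun x hx => by
      have h1 := ((hd1 x hx).differentiableAt (isOpen_Ioo.mem_nhds hx)).hasDerivAt.sub (hlin x)
      have h2 := h1.deriv
      rw [hcst x hx, sub_self] at h2
      exact h2)
  have hcl : Set.EqOn V (fun x : ℝ => w + x * c) (Set.Icc p q) := by
    refine Set.EqOn.of_subset_closure (s := Set.Ioo p q) (fun x hx => ?_) hc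
      (by fun_prop) Set.Ioo_subset_Icc_self (closure_Ioo hpq.ne).ge
    have := hw x hx
    rw [← this]; ring
  intro x hx
  rw [hcl hx, hcl (Set.left_mem_Icc.2 hpq.le), hcl (Set.right_mem_Icc.2 hpq.le)]
  have : ((q : ℂ) - p) ≠ 0 := by
    rw [← Complex.ofReal_sub]; exact_mod_cast (sub_pos.2 hpq).ne'
  push_cast
  field_simp
  ring

/-- The mean value inequality on a closed interval, with the derivative bound required only in
the interior. -/
lemma norm_sub_le_of_deriv_le_Ioo {φ : ℝ → ℂ} {p q K : ℝ} (hφ : ContDiff ℝ 1 φ) (hpq : p < q)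
    (hK : ∀ x ∈ Set.Ioo p q, ‖deriv φ x‖ ≤ K) {x y : ℝ} (hx : x ∈ Set.Icc p q)
    (hy : y ∈ Set.Icc p q) : ‖φ y - φ x‖ ≤ K * (q - p) := by
  have hcl : ∀ x ∈ Set.Icc p q, ‖deriv φ x‖ ≤ K := by
    have h1 : IsClosed {x | ‖deriv φ x‖ ≤ K} :=
      isClosed_le (hφ.continuous_deriv le_rfl).norm continuous_const
    rw [← closure_Ioo hpq.ne]
    exact fun x hx => closure_minimal hK h1 hx
  have h0 : 0 ≤ K := (norm_nonneg _).trans (hcl x hx)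
  refine ((convex_Icc p q).norm_image_sub_le_of_norm_deriv_le
    (fun z _ => hφ.differentiable (by norm_num) z) hcl hx hy).trans ?_
  refine mul_le_mul_of_nonneg_left ?_ h0
  rw [Real.norm_eq_abs, abs_le]
  constructor <;> linarith [hx.1, hx.2, hy.1, hy.2]

/-- First-order Taylor estimate: the slope of the chord of an interval is the derivative at
any of its points, up to the second derivative times the length. -/
lemma norm_deriv_sub_slope_le {φ : ℝ → ℂ} {p q K : ℝ} (hφ : ContDiff ℝ 2 φ) (hpq : p < q)
    (hK : ∀ x ∈ Set.Ioo p q, ‖iteratedDeriv 2 φ x‖ ≤ K) {x : ℝ} (hx : x ∈ Set.Icc p q) :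
    ‖deriv φ x - (φ q - φ p) / ((q - p : ℝ) : ℂ)‖ ≤ K * (q - p) := by
  have hφ' : ContDiff ℝ 1 (deriv φ) := by
    have := (contDiff_succ_iff_deriv (n := 1) (f := φ)).1 (by simpa [one_add_one_eq_two] using hφ)
    exact this.2.2
  have hlin : ContDiff ℝ 1 (fun z : ℝ => (z : ℂ) * deriv φ x) := by
    exact (Complex.ofRealCLM.contDiff).mul contDiff_const
  have hd : ∀ z : ℝ, HasDerivAt (fun z : ℝ => φ z - z * deriv φ x) (deriv φ z - deriv φ x) z :=
    fun z => by
      refine (hφ.differentiable (by norm_num) z).hasDerivAt.sub ?_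
      simpa using (Complex.ofRealCLM.hasDerivAt (x := z)).mul_const (deriv φ x)
  have h1 := norm_sub_le_of_deriv_le_Ioo (φ := fun z : ℝ => φ z - z * deriv φ x)
    (K := K * (q - p)) ((hφ.of_le (by norm_num)).sub hlin) hpq (fun z hz => by
      rw [(hd z).deriv]
      exact norm_sub_le_of_deriv_le_Ioo hφ' hpq
        (fun y hy => by simpa [iteratedDeriv_two] using hK y hy) hx (Set.Ioo_subset_Icc_self hz))
    (Set.left_mem_Icc.2 hpq.le) (Set.right_mem_Icc.2 hpq.le)
  have hpos : 0 < q - p := sub_pos.2 hpq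
  have hne : ((q - p : ℝ) : ℂ) ≠ 0 := by exact_mod_cast hpos.ne'
  have h2 : deriv φ x - (φ q - φ p) / ((q - p : ℝ) : ℂ)
      = -((φ q - q * deriv φ x) - (φ p - p * deriv φ x)) / ((q - p : ℝ) : ℂ) := by
    field_simp
    push_cast
    ring
  rw [h2, norm_div, norm_neg, Complex.norm_real, Real.norm_eq_abs, abs_of_pos hpos,
    div_le_iff₀ hpos]
  exact h1

namespace Geometry

variable {N : ℕ} (G : Geometry N)

/-! ### Piecewise affine potentials -/

/-- The continuous function that rises affinely from `0` to `1` across the `k`-th gap and is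
constant elsewhere. -/
noncomputable def ramp (k : ℤ) (x : ℝ) : ℝ := max 0 (min 1 ((x - G.hi k) / G.gapLen k))

lemma ramp_eq_zero {k : ℤ} {x : ℝ} (hx : x ≤ G.hi k) : G.ramp k x = 0 :=
  max_eq_left ((min_le_right _ _).trans
    (div_nonpos_of_nonpos_of_nonneg (sub_nonpos.2 hx) (G.gapLen_pos k).le))

lemma ramp_eq_one {k : ℤ} {x : ℝ} (hx : G.lo (k + 1) ≤ x) : G.ramp k x = 1 := by
  have h : 1 ≤ (x - G.hi k) / G.gapLen k := by
    rw [le_div_iff₀ (G.gapLen_pos k)]; unfold gapLen; linarith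
  rw [ramp, min_eq_left h, max_eq_right zero_le_one]

lemma ramp_eq_div {k : ℤ} {x : ℝ} (h1 : G.hi k ≤ x) (h2 : x ≤ G.lo (k + 1)) :
    G.ramp k x = (x - G.hi k) / G.gapLen k := by
  have h : (x - G.hi k) / G.gapLen k ≤ 1 := by
    rw [div_le_iff₀ (G.gapLen_pos k)]; unfold gapLen; linarith
  rw [ramp, min_eq_right h, max_eq_right (div_nonneg (sub_nonneg.2 h1) (G.gapLen_pos k).le)]

lemma continuous_ramp (k : ℤ) : Continuous (G.ramp k) := by
  unfold ramp; fun_prop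

lemma ramp_add_mul (m k : ℤ) (x : ℝ) : G.ramp (k + m * N) (x + m * G.L) = G.ramp k x := by
  unfold ramp
  rw [G.hi_add_mul, G.gapLen_add_mul, add_sub_add_right_eq_sub]

/-- The interpolation of the nodal values `c` on the `k`-th resonator and the gap to its right. -/
noncomputable def piece (c : ℤ → ℂ) (k : ℤ) (x : ℝ) : ℂ := c k + (c (k + 1) - c k) * G.ramp k x

/-- The continuous function equal to `c k` on the `k`-th resonator and affine on every gap. -/
noncomputable def interp (c : ℤ → ℂ) (x : ℝ) : ℂ := G.piece c (G.exists_mem_Ico x).choose x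

lemma interp_eq_of_mem_Ico (c : ℤ → ℂ) {k : ℤ} {x : ℝ}
    (hx : x ∈ Set.Ico (G.lo k) (G.lo (k + 1))) : G.interp c x = G.piece c k x := by
  rw [interp, G.eq_of_mem_Ico (G.exists_mem_Ico x).choose_spec hx]

lemma continuous_interp (c : ℤ → ℂ) : Continuous (G.interp c) := by
  rw [continuous_iff_continuousAt]
  intro x
  obtain ⟨k, hk⟩ := G.exists_mem_Ico x
  have hlt : G.lo (k - 1) < x := (G.lo_strictMono (sub_one_lt k)).trans_le hk.1
  have hc : ContinuousAt (fun y => G.piece c (k - 1) y + G.piece c k y - c k) x := by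
    have h1 := G.continuous_ramp (k - 1)
    have h2 := G.continuous_ramp k
    unfold piece
    fun_prop
  refine hc.congr ?_
  filter_upwards [Ioo_mem_nhds hlt hk.2] with y hy
  -- Left of `lo k` the piece `k` is constant, right of it the piece `k - 1` is.
  rcases lt_or_ge y (G.lo k) with h | h
  · have hm : y ∈ Set.Ico (G.lo (k - 1)) (G.lo (k - 1 + 1)) := by
      rw [sub_add_cancel]; exact ⟨hy.1.le, h⟩
    rw [G.interp_eq_of_mem_Ico c hm]
    have h0 : G.ramp k y = 0 := G.ramp_eq_zero (h.le.trans (G.lo_lt_hi k).le)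
    simp [piece, h0]
  · rw [G.interp_eq_of_mem_Ico c ⟨h, hy.2⟩]
    have h1 : G.ramp (k - 1) y = 1 := G.ramp_eq_one (by rwa [sub_add_cancel])
    simp [piece, h1]

lemma interp_of_mem_resonator (c : ℤ → ℂ) {k : ℤ} {x : ℝ}
    (hx : x ∈ Set.Icc (G.lo k) (G.hi k)) : G.interp c x = c k := by
  rw [G.interp_eq_of_mem_Ico c ⟨hx.1, hx.2.trans_lt (G.hi_lt_lo k)⟩, piece,
    G.ramp_eq_zero hx.2]
  simp

lemma interp_of_mem_gap (c : ℤ → ℂ) {k : ℤ} {x : ℝ} (hx : x ∈ G.gap k) :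
    G.interp c x = c k + (c (k + 1) - c k) * ((x - G.hi k) / G.gapLen k : ℝ) := by
  rw [G.interp_eq_of_mem_Ico c ⟨((G.lo_lt_hi k).trans hx.1).le, hx.2⟩, piece,
    G.ramp_eq_div hx.1.le hx.2.le]

/-- The values of `V_j^α` on the resonators of the whole chain. -/
noncomputable def nodalValue (α : ℝ) (j : Fin N) (k : ℤ) : ℂ :=
  Complex.exp (Complex.I * α * G.cellOf k * G.L) * if G.posOf k = j then 1 else 0

lemma nodalValue_add_mul (α : ℝ) (j : Fin N) (m k : ℤ) :
    G.nodalValue α j (k + m * N) =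
      Complex.exp (Complex.I * α * m * G.L) * G.nodalValue α j k := by
  rw [nodalValue, G.cellOf_add_mul, G.posOf_add_mul, nodalValue, ← mul_assoc, ← Complex.exp_add]
  push_cast
  ring_nf

lemma hasDerivAt_affine (a b : ℂ) (p g x : ℝ) :
    HasDerivAt (fun y : ℝ => a + b * ((y - p) / g : ℝ)) (b / g) x := by
  have h := (((Complex.ofRealCLM.hasDerivAt (x := x)).sub_const (p : ℂ)).div_const
    (g : ℂ)).const_mul b |>.const_add a
  have e : (fun y : ℝ => a + b * (((y - p) / g : ℝ) : ℂ)) =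
      fun y : ℝ => a + b * ((Complex.ofRealCLM y - (p : ℂ)) / (g : ℂ)) := by
    funext y; simp
  rw [e]
  exact h.congr_deriv (by simp [div_eq_mul_inv])

lemma isPotential_interp (α : ℝ) (j : Fin N) :
    G.IsPotential α j (G.interp (G.nodalValue α j)) where
  continuous := G.continuous_interp _
  contDiffOn k := by
    refine ContDiffOn.congr ?_ fun x hx => G.interp_of_mem_gap _ hx
    refine ContDiff.contDiffOn (contDiff_const.add (contDiff_const.mul ?_))
    exact Complex.ofRealCLM.contDiff.comp
      ((contDiff_id.sub contDiff_const).div_const (G.gapLen k))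
  harmonic k x hx := by
    rw [Set.EqOn.iteratedDeriv_of_isOpen (fun y hy => G.interp_of_mem_gap _ hy) isOpen_Ioo 2 hx,
      iteratedDeriv_two]
    have h : deriv (fun y : ℝ => G.nodalValue α j k + (G.nodalValue α j (k + 1) -
        G.nodalValue α j k) * ((y - G.hi k) / G.gapLen k : ℝ)) = fun _ => _ :=
      funext fun y => (hasDerivAt_affine _ _ _ _ y).deriv
    rw [h]
    exact deriv_const _ _
  on_resonator i x hx := by
    rw [G.interp_of_mem_resonator _ (Set.Ioo_subset_Icc_self hx), nodalValue, G.cellOf_idx,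
      G.posOf_idx]
    simp
  quasiperiodic m x := by
    obtain ⟨k, hk⟩ := G.exists_mem_Ico x
    have hk' : x + m * G.L ∈ Set.Ico (G.lo (k + m * N)) (G.lo (k + m * N + 1)) := by
      rw [show k + m * N + 1 = k + 1 + m * N by ring, G.lo_add_mul, G.lo_add_mul]
      exact ⟨by linarith [hk.1], by linarith [hk.2]⟩
    rw [G.interp_eq_of_mem_Ico _ hk, G.interp_eq_of_mem_Ico _ hk', piece, piece, G.ramp_add_mul,
      show k + m * N + 1 = k + 1 + m * N by ring, G.nodalValue_add_mul, G.nodalValue_add_mul]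
    ring

variable {G}

lemma IsPotential.eq_nodalValue {α : ℝ} {j : Fin N} {V : ℝ → ℂ} (hV : G.IsPotential α j V)
    {k : ℤ} {x : ℝ} (hx : x ∈ Set.Icc (G.lo k) (G.hi k)) : V x = G.nodalValue α j k := by
  have hopen : Set.EqOn V (fun _ => G.nodalValue α j k) (G.resonator k) := fun y hy => by
    have hk : k = idx 0 (G.posOf k) + G.cellOf k * N := by
      rw [idx_add_mul, zero_add, G.idx_cellOf_posOf]
    have h1 : y - G.cellOf k * G.L ∈ G.resonator (idx 0 (G.posOf k)) := by
      have h2 := G.lo_add_mul (G.cellOf k) (idx 0 (G.posOf k))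
      have h3 := G.hi_add_mul (G.cellOf k) (idx 0 (G.posOf k))
      rw [← hk] at h2 h3
      exact ⟨by linarith [hy.1], by linarith [hy.2]⟩
    have h4 := hV.quasiperiodic (G.cellOf k) (y - G.cellOf k * G.L)
    rw [sub_add_cancel, hV.on_resonator _ _ h1] at h4
    exact h4
  exact hopen.of_subset_closure hV.continuous.continuousOn continuousOn_const
    Set.Ioo_subset_Icc_self (closure_Ioo (G.lo_lt_hi k).ne).ge hx

lemma IsPotential.eq_interp {α : ℝ} {j : Fin N} {V : ℝ → ℂ} (hV : G.IsPotential α j V) :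
    V = G.interp (G.nodalValue α j) := by
  funext x
  obtain ⟨k, hk⟩ := G.exists_mem_Ico x
  rcases le_or_gt x (G.hi k) with h | h
  · rw [hV.eq_nodalValue ⟨hk.1, h⟩, G.interp_of_mem_resonator _ ⟨hk.1, h⟩]
  · rw [eq_affine_of_iteratedDeriv_two_eq_zero (G.hi_lt_lo k) hV.continuous.continuousOn
      (hV.contDiffOn k) (hV.harmonic k) x ⟨h.le, hk.2.le⟩,
      hV.eq_nodalValue (Set.right_mem_Icc.2 (G.lo_lt_hi k).le),
      hV.eq_nodalValue (Set.left_mem_Icc.2 (G.lo_lt_hi (k + 1)).le),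
      G.interp_of_mem_gap _ ⟨h, hk.2⟩, gapLen]

variable (G) in
theorem existsUnique_isPotential (α : ℝ) (j : Fin N) : ∃! V : ℝ → ℂ, G.IsPotential α j V :=
  ⟨_, G.isPotential_interp α j, fun _ hV => hV.eq_interp⟩

/-- The difference of the slopes of the piecewise affine interpolation on the two sides of the
`k`-th resonator. -/
noncomputable def slopeJump (G : Geometry N) (c : ℤ → ℂ) (k : ℤ) : ℂ :=
  (c k - c (k - 1)) / G.gapLen (k - 1) - (c (k + 1) - c k) / G.gapLen k

lemma IsPotential.boundaryFlux_eq {α : ℝ} {j : Fin N} {V : ℝ → ℂ} (hV : G.IsPotential α j V)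
    (i : Fin N) : G.boundaryFlux i V = G.slopeJump (G.nodalValue α j) (idx 0 i) := by
  have hder : ∀ k, ∀ x ∈ G.gap k, deriv V x =
      (G.nodalValue α j (k + 1) - G.nodalValue α j k) / G.gapLen k := fun k x hx => by
    rw [hV.eq_interp, deriv_eq_of_eqOn_Ioo (fun y hy => G.interp_of_mem_gap _ hy) x hx]
    exact (hasDerivAt_affine _ _ _ _ x).deriv
  have h1 := hder (idx 0 i - 1)
  rw [gap, sub_add_cancel] at h1
  have h0 := G.hi_lt_lo (idx 0 i - 1)
  rw [sub_add_cancel] at h0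
  rw [boundaryFlux, traceLeft_eq h0 h1 continuousAt_const,
    traceRight_eq (G.hi_lt_lo (idx 0 i)) (hder _) continuousAt_const, slopeJump]

end Geometry

/-! ### Estimates at a fixed time -/

/-- The mean of `φ` over the interval `(p, q)`. -/
noncomputable def mean (φ : ℝ → ℂ) (p q : ℝ) : ℂ := ((q - p)⁻¹ : ℝ) * ∫ x in p..q, φ x

lemma norm_sub_mean_le {φ : ℝ → ℂ} {p q K x : ℝ} (hφ : Continuous φ) (hpq : p < q)
    (h : ∀ y ∈ Set.Icc p q, ‖φ x - φ y‖ ≤ K) : ‖φ x - mean φ p q‖ ≤ K := by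
  have hpos : 0 < q - p := sub_pos.2 hpq
  have h1 : φ x - mean φ p q = ((q - p)⁻¹ : ℝ) * ∫ y in p..q, (φ x - φ y) := by
    rw [intervalIntegral.integral_sub intervalIntegrable_const (hφ.intervalIntegrable _ _),
      intervalIntegral.integral_const, mul_sub, mean, Complex.real_smul, ← mul_assoc,
      ← Complex.ofReal_mul, inv_mul_cancel₀ hpos.ne', Complex.ofReal_one, one_mul]
  have h2 : ‖∫ y in p..q, (φ x - φ y)‖ ≤ K * |q - p| :=
    intervalIntegral.norm_integral_le_of_norm_le_const fun y hy => by
      rw [Set.uIoc_of_le hpq.le] at hy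
      exact h y (Set.Ioc_subset_Icc_self hy)
  rw [abs_of_pos hpos] at h2
  rw [h1, norm_mul, Complex.norm_real, Real.norm_eq_abs, abs_of_pos (inv_pos.2 hpos),
    inv_mul_le_iff₀ hpos, mul_comm]
  exact h2

/-- A snapshot of a field along the chain: smooth functions `e k` on the `k`-th gap and `r k` on
the `k`-th resonator, coupled by the transmission conditions with source factors `σ k` (which stand
for `1 / s`) and contrasts `ε k`, of size at most `Λ δ`. -/
structure Snapshot {N : ℕ} (G : Geometry N) (Λ δ : ℝ) (σ ε : ℤ → ℝ) (e r : ℤ → ℝ → ℂ) :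
    Prop where
  contDiff_gap : ∀ k, ContDiff ℝ 2 (e k)
  contDiff_resonator : ∀ k, ContDiff ℝ 2 (r k)
  source_ne : ∀ k, σ k ≠ 0
  source_le : ∀ k, |σ k| ≤ Λ
  inv_source_le : ∀ k, |(σ k)⁻¹| ≤ Λ
  contrast_pos : ∀ k, 0 < ε k
  contrast_le : ∀ k, ε k ≤ Λ * δ
  value_lo : ∀ k, e k (G.lo (k + 1)) = σ (k + 1) * r (k + 1) (G.lo (k + 1))
  value_hi : ∀ k, e k (G.hi k) = σ k * r k (G.hi k)
  flux_lo : ∀ k, (ε (k + 1) : ℂ) * deriv (e k) (G.lo (k + 1)) =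
    σ (k + 1) * deriv (r (k + 1)) (G.lo (k + 1))
  flux_hi : ∀ k, (ε k : ℂ) * deriv (e k) (G.hi k) = σ k * deriv (r k) (G.hi k)

/-- On the `k`-th resonator and the gap to its right, a snapshot has size at most `b` in the gap
and second derivatives of size at most `K b d`. -/
structure SnapshotBound {N : ℕ} (G : Geometry N) (e r : ℤ → ℝ → ℂ) (K b d : ℝ) (k : ℤ) :
    Prop where
  gap_le : ∀ x ∈ G.gap k, ‖e k x‖ ≤ b
  gap_two_le : ∀ x ∈ G.gap k, ‖iteratedDeriv 2 (e k) x‖ ≤ K * b * d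
  resonator_two_le : ∀ x ∈ G.resonator k, ‖iteratedDeriv 2 (r k) x‖ ≤ K * b * d

lemma norm_le_Icc_of_Ioo {φ : ℝ → ℂ} {p q b : ℝ} (hφ : Continuous φ) (hpq : p < q)
    (h : ∀ x ∈ Set.Ioo p q, ‖φ x‖ ≤ b) : ∀ x ∈ Set.Icc p q, ‖φ x‖ ≤ b := by
  rw [← closure_Ioo hpq.ne]
  exact fun x hx => closure_minimal h (isClosed_le hφ.norm continuous_const) hx

lemma contDiff_one_deriv {φ : ℝ → ℂ} (hφ : ContDiff ℝ 2 φ) : ContDiff ℝ 1 (deriv φ) :=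
  ((contDiff_succ_iff_deriv (n := 1) (f := φ)).1 (by simpa [one_add_one_eq_two] using hφ)).2.2

/-- The constant in the bound on the oscillation inside a resonator, for lengths controlled by `B`
and second derivatives controlled by `K`. -/
noncomputable def oscConst (Λ B K : ℝ) : ℝ := (Λ ^ 2 * (2 + K) + K) * B ^ 2

/-- The constant in the slope estimate across a gap. -/
noncomputable def slopeConst (Λ B K : ℝ) : ℝ := (K + 2 * Λ * oscConst Λ B K) * B

namespace Snapshot

variable {N : ℕ} {G : Geometry N} {Λ δ : ℝ} {σ ε : ℤ → ℝ} {e r : ℤ → ℝ → ℂ} {K b d B : ℝ}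

/-- The slope of the exterior field at the resonator is at most of order `b`, so the contrast makes
the slope of the interior field small. -/
lemma norm_deriv_hi_le (S : Snapshot G Λ δ σ ε e r) (hΛ : 0 ≤ Λ)
    (hB : ∀ k, G.gapLen k ≤ B ∧ (G.gapLen k)⁻¹ ≤ B ∧ G.resLen k ≤ B)
    (hK : 0 ≤ K) (hb : 0 ≤ b) (hδ : 0 ≤ δ) (hδd : δ ≤ d) (hd : d ≤ 1) {k : ℤ}
    (hk : SnapshotBound G e r K b d k) :
    ‖deriv (r k) (G.hi k)‖ ≤ Λ ^ 2 * (2 + K) * B * b * d := by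
  have hg := G.gapLen_pos k
  have hd0 : 0 ≤ d := hδ.trans hδd
  have hlt := G.hi_lt_lo k
  have h1 := norm_deriv_sub_slope_le (S.contDiff_gap k) hlt hk.gap_two_le
    (Set.left_mem_Icc.2 hlt.le)
  have hcl := norm_le_Icc_of_Ioo (S.contDiff_gap k).continuous hlt hk.gap_le
  have h2 : ‖(e k (G.lo (k + 1)) - e k (G.hi k)) / ((G.lo (k + 1) - G.hi k : ℝ) : ℂ)‖
      ≤ 2 * b * B := by
    rw [norm_div, Complex.norm_real, Real.norm_eq_abs,
      abs_of_pos (show 0 < G.lo (k + 1) - G.hi k from hg), div_eq_mul_inv]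
    refine mul_le_mul ?_ (hB k).2.1 (inv_nonneg.2 hg.le) (by positivity)
    refine (norm_sub_le _ _).trans ?_
    linarith [hcl _ (Set.left_mem_Icc.2 hlt.le), hcl _ (Set.right_mem_Icc.2 hlt.le)]
  have h3 : ‖deriv (e k) (G.hi k)‖ ≤ (2 + K) * B * b := by
    have h4 : K * b * d * (G.lo (k + 1) - G.hi k) ≤ K * b * 1 * B := by
      have := (hB k).1
      exact mul_le_mul (mul_le_mul_of_nonneg_left hd (by positivity)) this hg.le
        (by positivity)
    have h5 := norm_sub_norm_le (deriv (e k) (G.hi k))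
      ((e k (G.lo (k + 1)) - e k (G.hi k)) / ((G.lo (k + 1) - G.hi k : ℝ) : ℂ))
    linarith
  have h6 : deriv (r k) (G.hi k) = ((σ k)⁻¹ : ℝ) * (ε k : ℂ) * deriv (e k) (G.hi k) := by
    have hσ : (σ k : ℂ) ≠ 0 := by exact_mod_cast S.source_ne k
    rw [mul_assoc, S.flux_hi k]
    push_cast
    field_simp
  rw [h6, norm_mul, norm_mul, Complex.norm_real, Complex.norm_real, Real.norm_eq_abs,
    Real.norm_eq_abs, abs_of_pos (S.contrast_pos k)]
  calc |(σ k)⁻¹| * ε k * ‖deriv (e k) (G.hi k)‖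
      ≤ Λ * (Λ * d) * ((2 + K) * B * b) := by
        refine mul_le_mul (mul_le_mul (S.inv_source_le k) ?_ (S.contrast_pos k).le hΛ) h3
          (norm_nonneg _) (by positivity)
        exact (S.contrast_le k).trans (mul_le_mul_of_nonneg_left hδd hΛ)
    _ = _ := by ring

/-- Inside a resonator the field is constant up to an error of order `d`. -/
lemma norm_sub_le (S : Snapshot G Λ δ σ ε e r) (hΛ : 0 ≤ Λ)
    (hB : ∀ k, G.gapLen k ≤ B ∧ (G.gapLen k)⁻¹ ≤ B ∧ G.resLen k ≤ B)
    (hK : 0 ≤ K) (hb : 0 ≤ b) (hδ : 0 ≤ δ) (hδd : δ ≤ d) (hd : d ≤ 1) {k : ℤ}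
    (hk : SnapshotBound G e r K b d k) {x y : ℝ} (hx : x ∈ Set.Icc (G.lo k) (G.hi k))
    (hy : y ∈ Set.Icc (G.lo k) (G.hi k)) :
    ‖r k x - r k y‖ ≤ oscConst Λ B K * b * d := by
  have hd0 : 0 ≤ d := hδ.trans hδd
  have hlt := G.lo_lt_hi k
  have hB0 : 0 ≤ B := (G.resLen_pos k).le.trans (hB k).2.2
  have h1 := S.norm_deriv_hi_le hΛ hB hK hb hδ hδd hd hk
  have h2 : ∀ z ∈ Set.Ioo (G.lo k) (G.hi k),
      ‖deriv (r k) z‖ ≤ (Λ ^ 2 * (2 + K) + K) * B * b * d := fun z hz => by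
    have h3 := norm_sub_le_of_deriv_le_Ioo (contDiff_one_deriv (S.contDiff_resonator k)) hlt
      (fun w hw => by simpa [iteratedDeriv_two] using hk.resonator_two_le w hw)
      (Set.right_mem_Icc.2 hlt.le) (Set.Ioo_subset_Icc_self hz)
    have h4 : K * b * d * (G.hi k - G.lo k) ≤ K * b * d * B :=
      mul_le_mul_of_nonneg_left (hB k).2.2 (by positivity)
    have h5 := norm_sub_norm_le (deriv (r k) z) (deriv (r k) (G.hi k))
    linarith
  refine (norm_sub_le_of_deriv_le_Ioo ((S.contDiff_resonator k).of_le (by norm_num)) hlt h2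
    hy hx).trans ?_
  calc (Λ ^ 2 * (2 + K) + K) * B * b * d * (G.hi k - G.lo k)
      ≤ (Λ ^ 2 * (2 + K) + K) * B * b * d * B :=
        mul_le_mul_of_nonneg_left (hB k).2.2 (by positivity)
    _ = _ := by rw [oscConst]; ring

lemma norm_sub_mean_le (S : Snapshot G Λ δ σ ε e r) (hΛ : 0 ≤ Λ)
    (hB : ∀ k, G.gapLen k ≤ B ∧ (G.gapLen k)⁻¹ ≤ B ∧ G.resLen k ≤ B)
    (hK : 0 ≤ K) (hb : 0 ≤ b) (hδ : 0 ≤ δ) (hδd : δ ≤ d) (hd : d ≤ 1) {k : ℤ}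
    (hk : SnapshotBound G e r K b d k) {x : ℝ} (hx : x ∈ Set.Icc (G.lo k) (G.hi k)) :
    ‖r k x - mean (r k) (G.lo k) (G.hi k)‖ ≤ oscConst Λ B K * b * d :=
  SpaceTimeDefect.norm_sub_mean_le (S.contDiff_resonator k).continuous (G.lo_lt_hi k)
    fun _ hy => S.norm_sub_le hΛ hB hK hb hδ hδd hd hk hx hy

/-- In a gap the slope of the field is, up to an error of order `d`, that of the affine
interpolation of the rescaled resonator means. -/
lemma norm_deriv_gap_sub_le (S : Snapshot G Λ δ σ ε e r) (hΛ : 0 ≤ Λ)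
    (hB : ∀ k, G.gapLen k ≤ B ∧ (G.gapLen k)⁻¹ ≤ B ∧ G.resLen k ≤ B)
    (hK : 0 ≤ K) (hb : 0 ≤ b) (hδ : 0 ≤ δ) (hδd : δ ≤ d) (hd : d ≤ 1) {k : ℤ}
    (hk : SnapshotBound G e r K b d k) (hk1 : SnapshotBound G e r K b d (k + 1)) {x : ℝ}
    (hx : x ∈ Set.Icc (G.hi k) (G.lo (k + 1))) :
    ‖deriv (e k) x - (σ (k + 1) * mean (r (k + 1)) (G.lo (k + 1)) (G.hi (k + 1))
        - σ k * mean (r k) (G.lo k) (G.hi k)) / G.gapLen k‖ ≤ slopeConst Λ B K * b * d := by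
  have hd0 : 0 ≤ d := hδ.trans hδd
  have hg := G.gapLen_pos k
  have h1 := norm_deriv_sub_slope_le (S.contDiff_gap k) (G.hi_lt_lo k) hk.gap_two_le hx
  have h1' : K * b * d * (G.lo (k + 1) - G.hi k) ≤ K * b * d * B :=
    mul_le_mul_of_nonneg_left (hB k).1 (by positivity)
  set q1 := mean (r (k + 1)) (G.lo (k + 1)) (G.hi (k + 1)) with hq1
  set q0 := mean (r k) (G.lo k) (G.hi k) with hq0
  have h2 := S.norm_sub_mean_le hΛ hB hK hb hδ hδd hd hk
    (Set.right_mem_Icc.2 (G.lo_lt_hi k).le)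
  have h3 := S.norm_sub_mean_le hΛ hB hK hb hδ hδd hd hk1
    (Set.left_mem_Icc.2 (G.lo_lt_hi (k + 1)).le)
  have h4 : ‖((e k (G.lo (k + 1)) - e k (G.hi k)) - (σ (k + 1) * q1 - σ k * q0)) /
      (G.gapLen k : ℂ)‖ ≤ 2 * (Λ * (oscConst Λ B K * b * d)) * B := by
    rw [norm_div, Complex.norm_real, Real.norm_eq_abs, abs_of_pos hg, div_eq_mul_inv]
    have h0 : 0 ≤ oscConst Λ B K * b * d := (norm_nonneg _).trans h2
    refine mul_le_mul ?_ (hB k).2.1 (inv_nonneg.2 hg.le) (by positivity)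
    rw [S.value_lo, S.value_hi, show (σ (k + 1) : ℂ) * r (k + 1) (G.lo (k + 1)) -
      σ k * r k (G.hi k) - (σ (k + 1) * q1 - σ k * q0) =
      σ (k + 1) * (r (k + 1) (G.lo (k + 1)) - q1) - σ k * (r k (G.hi k) - q0) by ring]
    refine (_root_.norm_sub_le _ _).trans ?_
    rw [norm_mul, norm_mul, Complex.norm_real, Complex.norm_real, Real.norm_eq_abs,
      Real.norm_eq_abs, two_mul]
    exact add_le_add (mul_le_mul (S.source_le _) h3 (norm_nonneg _) hΛ)
      (mul_le_mul (S.source_le _) h2 (norm_nonneg _) hΛ)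
  have h5 : deriv (e k) x - (σ (k + 1) * q1 - σ k * q0) / G.gapLen k =
      (deriv (e k) x - (e k (G.lo (k + 1)) - e k (G.hi k)) / ((G.lo (k + 1) - G.hi k : ℝ) : ℂ)) +
      ((e k (G.lo (k + 1)) - e k (G.hi k)) - (σ (k + 1) * q1 - σ k * q0)) /
        (G.gapLen k : ℂ) := by
    rw [Geometry.gapLen]; ring
  rw [h5]
  refine (norm_add_le _ _).trans ((add_le_add (h1.trans h1') h4).trans (le_of_eq ?_))
  rw [slopeConst]; ring

/-- The jump of the slopes of the interpolated means across a resonator is, up to an error of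
order `d`, the flux out of the resonator divided by the contrast. -/
lemma norm_slopeJump_sub_le (S : Snapshot G Λ δ σ ε e r) (hΛ : 0 ≤ Λ)
    (hB : ∀ k, G.gapLen k ≤ B ∧ (G.gapLen k)⁻¹ ≤ B ∧ G.resLen k ≤ B)
    (hK : 0 ≤ K) (hb : 0 ≤ b) (hδ : 0 ≤ δ) (hδd : δ ≤ d) (hd : d ≤ 1) {k : ℤ}
    (hk0 : SnapshotBound G e r K b d (k - 1)) (hk : SnapshotBound G e r K b d k)
    (hk1 : SnapshotBound G e r K b d (k + 1)) :
    ‖G.slopeJump (fun k => σ k * mean (r k) (G.lo k) (G.hi k)) k -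
      (σ k / ε k : ℝ) * (deriv (r k) (G.lo k) - deriv (r k) (G.hi k))‖ ≤
        2 * slopeConst Λ B K * b * d := by
  have hε : (ε k : ℂ) ≠ 0 := by exact_mod_cast (S.contrast_pos k).ne'
  have hlo := S.flux_lo (k - 1)
  have hlt := G.hi_lt_lo (k - 1)
  have h1 := S.norm_deriv_gap_sub_le hΛ hB hK hb hδ hδd hd hk0 (by rwa [sub_add_cancel])
    (Set.right_mem_Icc.2 hlt.le)
  have h2 := S.norm_deriv_gap_sub_le hΛ hB hK hb hδ hδd hd hk hk1
    (Set.left_mem_Icc.2 (G.hi_lt_lo k).le)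
  rw [sub_add_cancel] at hlo h1
  have e1 : (σ k / ε k : ℝ) * (deriv (r k) (G.lo k) - deriv (r k) (G.hi k)) =
      deriv (e (k - 1)) (G.lo k) - deriv (e k) (G.hi k) := by
    push_cast
    rw [div_mul_eq_mul_div, mul_sub, ← hlo, ← S.flux_hi k]
    field_simp
  rw [e1, Geometry.slopeJump]
  rw [norm_sub_rev] at h1
  refine le_trans (le_of_eq ?_) ((norm_add_le _ _).trans (add_le_add h1 h2 |>.trans_eq ?_))
  · congr 1; ring
  · ring

end Snapshot

/-! ### Differentiation in time -/

/-- The partial derivative in the second variable, time. -/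
noncomputable def dt (U : ℝ × ℝ → ℂ) (p : ℝ × ℝ) : ℂ := fderiv ℝ U p (0, 1)

lemma hasDerivAt_dt {U : ℝ × ℝ → ℂ} (hU : ContDiff ℝ 1 U) (x t : ℝ) :
    HasDerivAt (fun τ => U (x, τ)) (dt U (x, t)) t :=
  ((hU.differentiable (by norm_num) (x, t)).hasFDerivAt).comp_hasDerivAt t
    ((hasDerivAt_const t x).prodMk (hasDerivAt_id t))

lemma contDiff_dt {U : ℝ × ℝ → ℂ} (hU : ContDiff ℝ 2 U) : ContDiff ℝ 1 (dt U) :=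
  (hU.fderiv_right (m := 1) (by norm_num [one_add_one_eq_two])).clm_apply contDiff_const

lemma continuous_dt {U : ℝ × ℝ → ℂ} (hU : ContDiff ℝ 1 U) : Continuous (dt U) :=
  (hU.continuous_fderiv (by norm_num)).clm_apply continuous_const

lemma hasDerivAt_integral_dt {U : ℝ × ℝ → ℂ} (hU : ContDiff ℝ 1 U) (p q t : ℝ) :
    HasDerivAt (fun τ => ∫ x in p..q, U (x, τ)) (∫ x in p..q, dt U (x, t)) t := by
  have hc := continuous_dt hU
  obtain ⟨C, hC⟩ := ((isCompact_uIcc (a := p) (b := q)).prod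
    (isCompact_closedBall t 1)).exists_bound_of_continuousOn hc.continuousOn
  refine (intervalIntegral.hasDerivAt_integral_of_dominated_loc_of_deriv_le (𝕜 := ℝ)
    (F := fun τ x => U (x, τ)) (F' := fun τ x => dt U (x, τ)) (bound := fun _ => C)
    (Metric.closedBall_mem_nhds t one_pos) ?_ ?_ ?_ ?_ intervalIntegrable_const ?_).2
  · exact Eventually.of_forall fun τ =>
      (hU.continuous.comp (by fun_prop : Continuous fun x : ℝ => (x, τ))).aestronglyMeasurable
  · exact (hU.continuous.comp (by fun_prop : Continuous fun x : ℝ => (x, t))).intervalIntegrable _ _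
  · exact (hc.comp (by fun_prop : Continuous fun x : ℝ => (x, t))).aestronglyMeasurable
  · exact Eventually.of_forall fun x hx τ hτ => hC (x, τ) ⟨Set.uIoc_subset_uIcc hx, hτ⟩
  · exact Eventually.of_forall fun x _ τ _ => hasDerivAt_dt hU x τ

lemma hasDerivAt_mean {U : ℝ × ℝ → ℂ} (hU : ContDiff ℝ 1 U) (p q t : ℝ) :
    HasDerivAt (fun τ => mean (fun x => U (x, τ)) p q) (mean (fun x => dt U (x, t)) p q) t :=
  (hasDerivAt_integral_dt hU p q t).const_mul _

lemma norm_mean_le {φ : ℝ → ℂ} {p q K : ℝ} (hφ : Continuous φ) (hpq : p < q)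
    (h : ∀ x ∈ Set.Ioo p q, ‖φ x‖ ≤ K) : ‖mean φ p q‖ ≤ K := by
  have h1 := norm_le_Icc_of_Ioo hφ hpq h
  have hpos : 0 < q - p := sub_pos.2 hpq
  have h2 : ‖∫ y in p..q, φ y‖ ≤ K * |q - p| :=
    intervalIntegral.norm_integral_le_of_norm_le_const fun y hy => by
      rw [Set.uIoc_of_le hpq.le] at hy
      exact h1 y (Set.Ioc_subset_Icc_self hy)
  rw [abs_of_pos hpos] at h2
  rw [mean, norm_mul, Complex.norm_real, Real.norm_eq_abs, abs_of_pos (inv_pos.2 hpos),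
    inv_mul_le_iff₀ hpos, mul_comm]
  exact h2

/-- The mean of a second derivative is a difference quotient of the first derivative. The equation
for `ψ` is only available in the interior, as the wave equation is. -/
lemma mean_eq_of_eq_iteratedDeriv_two {φ ψ : ℝ → ℂ} {p q : ℝ} (hφ : ContDiff ℝ 2 φ)
    (hpq : p < q) (c : ℂ)
    (h : ∀ x ∈ Set.Ioo p q, ψ x = c * iteratedDeriv 2 φ x) :
    mean ψ p q = c * ((q - p)⁻¹ : ℝ) * (deriv φ q - deriv φ p) := by
  have hd := contDiff_one_deriv hφ
  have h1 : ∫ x in p..q, ψ x = ∫ x in p..q, c * deriv (deriv φ) x := by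
    refine intervalIntegral.integral_congr_ae ?_
    have h2 : ∀ᵐ x : ℝ, x ≠ q := by simp [ae_iff, measure_singleton]
    filter_upwards [h2] with x hx hm
    rw [Set.uIoc_of_le hpq.le] at hm
    rw [h x ⟨hm.1, lt_of_le_of_ne hm.2 hx⟩, iteratedDeriv_two]
  rw [mean, h1, intervalIntegral.integral_const_mul,
    intervalIntegral.integral_eq_sub_of_hasDerivAt
      (fun x _ => (hd.differentiable (by norm_num) x).hasDerivAt)
      ((hd.continuous_deriv le_rfl).intervalIntegrable _ _)]
  ring

/-- Termwise differentiation of a weighted series at times in an open set where the derivatives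
have a summable bound. -/
lemma hasDerivAt_tsum_mul {g g' : ℤ → ℝ → ℂ} {w : ℤ → ℂ} {v : ℤ → ℝ} {J : Set ℝ} {W : ℝ}
    (hJ : IsOpen J) (hv : Summable v) (hw : ∀ m, ‖w m‖ ≤ W)
    (hg : ∀ m t, HasDerivAt (g m) (g' m t) t) (hb : ∀ m, ∀ t ∈ J, ‖g' m t‖ ≤ v m)
    (hs : ∀ t ∈ J, Summable fun m => g m t * w m) {t : ℝ} (ht : t ∈ J) :
    HasDerivAt (fun τ => ∑' m, g m τ * w m) (∑' m, g' m t * w m) t := by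
  obtain ⟨ρ, hρ, hball⟩ := Metric.isOpen_iff.1 hJ t ht
  have hW : 0 ≤ W := (norm_nonneg _).trans (hw 0)
  refine hasDerivAt_tsum_of_isPreconnected (u := fun m => v m * W) (hv.mul_right W)
    Metric.isOpen_ball (convex_ball t ρ).isPreconnected (y₀ := t)
    (fun m y _ => (hg m y).mul_const (w m)) (fun m y hy => ?_) (Metric.mem_ball_self hρ) (hs t ht)
    (Metric.mem_ball_self hρ)
  rw [norm_mul]
  exact mul_le_mul (hb m y (hball hy)) (hw m) (norm_nonneg _)
    ((norm_nonneg _).trans (hb m y (hball hy)))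

lemma summable_mul_of_norm_le {z w : ℤ → ℂ} {v : ℤ → ℝ} {W : ℝ} (hv : Summable v)
    (hz : ∀ m, ‖z m‖ ≤ v m) (hw : ∀ m, ‖w m‖ ≤ W) : Summable fun m => z m * w m := by
  refine Summable.of_norm_bounded (hv.mul_right W) fun m => ?_
  rw [norm_mul]
  exact mul_le_mul (hz m) (hw m) (norm_nonneg _) ((norm_nonneg _).trans (hz m))

lemma Material.differentiable_invκ {N : ℕ} (P : Material N) (i : Fin N) :
    Differentiable ℝ (P.invκ i) := by
  have h1 : (fun t => 1 / P.κp i t) = fun t : ℝ => (∑ n ∈ Finset.Icc (-(P.M : ℤ)) P.M,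
      P.kCoeff i n * Complex.exp (Complex.I * n * P.Ω * t)).re := by
    funext t
    rw [← P.κp_fourier, Complex.ofReal_re]
  have h2 : Differentiable ℝ fun t => 1 / P.κp i t := by
    rw [h1]
    refine Complex.reCLM.differentiable.comp (Differentiable.fun_sum fun n _ => ?_)
    have h3 : Differentiable ℝ fun t : ℝ => (t : ℂ) := Complex.ofRealCLM.differentiable
    exact ((h3.const_mul _).cexp).const_mul _
  exact h2.add ((P.f_contDiff.differentiable (by norm_num)).const_mul _)

/-! ### Localisation and Floquet-Bloch sums -/

section Localisation

variable {N : ℕ} {G : Geometry N}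

lemma Geometry.norm_phase (α : ℝ) (m : ℤ) : ‖G.phase α m‖ = 1 := by
  have h : -(Complex.I * α * m * G.L) = ((-(α * m * G.L) : ℝ) : ℂ) * Complex.I := by
    push_cast; ring
  rw [Geometry.phase, h, Complex.norm_exp_ofReal_mul_I]

lemma Geometry.resonator_subset_Ico (k : ℤ) : G.resonator k ⊆ Set.Ico (G.lo k) (G.lo (k + 1)) :=
  fun _ hx => ⟨hx.1.le, hx.2.trans (G.hi_lt_lo k)⟩

lemma Geometry.gap_subset_Ico (k : ℤ) : G.gap k ⊆ Set.Ico (G.lo k) (G.lo (k + 1)) :=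
  fun _ hx => ⟨((G.lo_lt_hi k).trans hx.1).le, hx.2⟩

/-- Summing the local sizes over five neighbouring cells bounds the field on the resonators of the
middle cell, on their neighbours and on the gaps between them. Gaps may cross cell boundaries. -/
lemma IsLocalisedSubwavelength.exists_bound {δ γ A : ℝ} {J : Set ℝ} {u : ℝ → ℝ → ℂ}
    (h : IsLocalisedSubwavelength G δ γ A J u) (hδ : 0 ≤ δ) (hJ : J.Nonempty) :
    ∃ b : ℤ → ℝ, (∀ m, 0 ≤ b m) ∧ Summable b ∧ ∑' m, b m ≤ 5 * A ∧
      ∀ m (i : Fin N) k, |k - idx m i| ≤ 1 → ∀ x ∈ G.resonator k ∪ G.gap k, ∀ t ∈ J,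
        ‖u x t‖ ≤ b m ∧
        ‖deriv (fun τ => u x τ) t‖ ≤ b m * δ ^ ((1 - γ) / 2) ∧
        ‖iteratedDeriv 2 (fun τ => u x τ) t‖ ≤ b m * δ ^ ((1 - γ) / 2) := by
  obtain ⟨a, ha, hA, hu⟩ := h
  obtain ⟨t₀, ht₀⟩ := hJ
  have ha0 : ∀ n, 0 ≤ a n := fun n => by
    obtain ⟨x, hx⟩ := exists_between (G.lo_lt_hi (N + n * N))
    exact (norm_nonneg _).trans
      (hu n x (G.resonator_subset_cell n hx) ⟨_, Or.inl hx⟩ t₀ ht₀).1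
  have hshift : ∀ r : ℤ, Summable fun m => a (m + r) := fun r =>
    (Equiv.addRight r).summable_iff.2 ha
  refine ⟨fun m => ∑ r ∈ Finset.Icc (-2 : ℤ) 2, a (m + r),
    fun m => Finset.sum_nonneg fun r _ => ha0 _, summable_sum fun r _ => hshift r, ?_,
    fun m i k hk x hx t ht => ?_⟩
  · rw [Summable.tsum_finsetSum fun r _ => hshift r]
    have h1 : ∀ r : ℤ, ∑' m, a (m + r) = ∑' m, a m := fun r => (Equiv.addRight r).tsum_eq a
    have h2 : (Finset.Icc (-2 : ℤ) 2).card = 5 := rfl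
    simp only [h1, Finset.sum_const, h2, nsmul_eq_mul]
    push_cast
    linarith
  · have hL := G.L_pos
    have hn : x ∈ Set.Ico ((⌊x / G.L⌋ : ℤ) * G.L) (((⌊x / G.L⌋ : ℤ) + 1) * G.L) :=
      ⟨(le_div_iff₀ hL).1 (Int.floor_le _), (div_lt_iff₀ hL).1 (Int.lt_floor_add_one _)⟩
    set n := ⌊x / G.L⌋
    have hxk : x ∈ Set.Ico (G.lo k) (G.lo (k + 1)) :=
      hx.elim (fun h => G.resonator_subset_Ico k h) (fun h => G.gap_subset_Ico k h)
    have habs := abs_le.1 (G.abs_sub_le_of_mem hk hxk hn)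
    have hle : a n ≤ ∑ r ∈ Finset.Icc (-2 : ℤ) 2, a (m + r) := by
      have h2 := Finset.single_le_sum (s := Finset.Icc (-2 : ℤ) 2) (f := fun r => a (m + r))
        (fun r _ => ha0 _) (Finset.mem_Icc.2 ⟨habs.1, habs.2⟩)
      simpa using h2
    obtain ⟨u0, u1, u2⟩ := hu n x hn ⟨k, hx⟩ t ht
    have hd : 0 ≤ δ ^ ((1 - γ) / 2) := Real.rpow_nonneg hδ _
    have hle' := mul_le_mul_of_nonneg_right hle hd
    exact ⟨u0.trans hle, u1.trans hle', u2.trans hle'⟩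

/-- The Bloch sum of the rescaled values, unfolded along the chain, is the superposition of the
nodal values of the potentials. -/
lemma hasSum_nodalValue (α : ℝ) (s : Fin N → ℝ) (z : ℤ → Fin N → ℂ)
    (hz : ∀ i, Summable fun m => z m i * G.phase α m) (k : ℤ) :
    HasSum (fun n => ((1 / s (G.posOf k) : ℝ) * z (G.cellOf (k + n * N)) (G.posOf k)) *
        G.phase α n)
      (∑ j, (1 / s j : ℝ) * G.nodalValue α j k * ∑' m, z m j * G.phase α m) := by
  have h1 : ∑ j, (1 / s j : ℝ) * G.nodalValue α j k * ∑' m, z m j * G.phase α m =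
      (1 / s (G.posOf k) : ℝ) * Complex.exp (Complex.I * α * G.cellOf k * G.L) *
        ∑' m, z m (G.posOf k) * G.phase α m := by
    rw [Finset.sum_eq_single (G.posOf k)]
    · simp [Geometry.nodalValue]
    · intro j _ hj
      simp [Geometry.nodalValue, hj.symm]
    · simp
  rw [h1]
  have h2 := (Equiv.addLeft (G.cellOf k)).hasSum_iff.2 (hz (G.posOf k)).hasSum
  refine (h2.mul_left _).congr_fun fun n => ?_
  have h3 : G.phase α n = Complex.exp (Complex.I * α * G.cellOf k * G.L) *
      G.phase α (G.cellOf k + n) := by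
    rw [Geometry.phase, Geometry.phase, ← Complex.exp_add]
    push_cast
    ring_nf
  rw [h3, G.cellOf_add_mul]
  simp only [Function.comp_apply, Equiv.coe_addLeft]
  ring

/-- The capacitance matrix acts on Bloch sums as the slope jump of the interpolated values, summed
over the cells. -/
lemma hasSum_capacitance {α : ℝ} {V : Fin N → ℝ → ℂ} (hV : ∀ j, G.IsPotential α j (V j))
    (s : Fin N → ℝ) (z : ℤ → Fin N → ℂ)
    (hz : ∀ i, Summable fun m => z m i * G.phase α m) (i : Fin N) :
    HasSum (fun n => G.slopeJump
        (fun k => (1 / s (G.posOf k) : ℝ) * z (G.cellOf k) (G.posOf k)) (idx n i) * G.phase α n)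
      (∑ j, (1 / s j : ℝ) * G.capacitance V i j * ∑' m, z m j * G.phase α m) := by
  have h0 := hasSum_nodalValue α s z hz (idx 0 i)
  have hm := hasSum_nodalValue α s z hz (idx 0 i - 1)
  have hp := hasSum_nodalValue α s z hz (idx 0 i + 1)
  have h := ((h0.sub hm).div_const (G.gapLen (idx 0 i - 1) : ℂ)).sub
    ((hp.sub h0).div_const (G.gapLen (idx 0 i) : ℂ))
  rw [← Finset.sum_sub_distrib, ← Finset.sum_sub_distrib, Finset.sum_div, Finset.sum_div,
    ← Finset.sum_sub_distrib] at h
  have e : ∀ j, (1 / s j : ℝ) * G.capacitance V i j * ∑' m, z m j * G.phase α m =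
      ((1 / s j : ℝ) * G.nodalValue α j (idx 0 i) * ∑' m, z m j * G.phase α m -
        (1 / s j : ℝ) * G.nodalValue α j (idx 0 i - 1) * ∑' m, z m j * G.phase α m) /
          G.gapLen (idx 0 i - 1) -
      ((1 / s j : ℝ) * G.nodalValue α j (idx 0 i + 1) * ∑' m, z m j * G.phase α m -
        (1 / s j : ℝ) * G.nodalValue α j (idx 0 i) * ∑' m, z m j * G.phase α m) /
          G.gapLen (idx 0 i) := fun j => by
    rw [Geometry.capacitance, (hV j).boundaryFlux_eq, Geometry.slopeJump]
    ring
  rw [Finset.sum_congr rfl fun j _ => e j]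
  refine h.congr_fun fun n => ?_
  have e0 : idx n i = idx 0 i + n * N := by rw [Geometry.idx_add_mul, zero_add]
  have em : idx n i - 1 = (idx 0 i - 1) + n * N := by rw [e0]; ring
  have ep : idx n i + 1 = (idx 0 i + 1) + n * N := by rw [e0]; ring
  rw [Geometry.slopeJump, em, ep, e0]
  simp only [G.posOf_add_mul, G.gapLen_add_mul]
  ring

end Localisation

/-! ### Snapshots of a solution -/

/-- Extensions `E k`, `R k` to the whole space-time of the restrictions of `u` to the `k`-th gap
and the `k`-th resonator. -/
structure Extension {N : ℕ} (G : Geometry N) (u : ℝ → ℝ → ℂ) (E R : ℤ → ℝ × ℝ → ℂ) : Prop where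
  contDiff_gap : ∀ k, ContDiff ℝ 2 (E k)
  contDiff_resonator : ∀ k, ContDiff ℝ 2 (R k)
  eq_gap : ∀ k, ∀ x ∈ G.gap k, ∀ t, u x t = E k (x, t)
  eq_resonator : ∀ k, ∀ x ∈ G.resonator k, ∀ t, u x t = R k (x, t)

lemma Material.IsSolution.exists_extension {N : ℕ} {G : Geometry N} {P : Material N}
    {u : ℝ → ℝ → ℂ} (hu : P.IsSolution G u) : ∃ E R, Extension G u E R := by
  choose R hR hR' using hu.regular_resonator
  choose E hE hE' using hu.regular_gap
  exact ⟨E, R, hE, hR, hE', hR'⟩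

lemma contDiff_slice {U : ℝ × ℝ → ℂ} (hU : ContDiff ℝ 2 U) (t : ℝ) :
    ContDiff ℝ 2 fun x => U (x, t) :=
  hU.comp (contDiff_id.prodMk contDiff_const)

lemma continuous_slice {U : ℝ × ℝ → ℂ} (hU : Continuous U) (t : ℝ) :
    Continuous fun x => U (x, t) :=
  hU.comp (by fun_prop)

section Material

variable {N : ℕ} {P : Material N} {Λ δ : ℝ}

lemma Material.vr_pos (P : Material N) (m : ℤ) (i : Fin N) :
    0 < P.vr m i :=
  Real.sqrt_pos.2 (div_pos P.κr_pos (P.ρr_pos m i))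

lemma Material.v₀_pos (P : Material N) : 0 < P.v₀ :=
  Real.sqrt_pos.2 (div_pos P.κ₀_pos P.ρ₀_pos)

lemma Material.HighContrast.nonneg (hP : P.HighContrast Λ δ) : 0 ≤ Λ :=
  (one_div_pos.2 P.v₀_pos).le.trans hP.background

/-- A bound on `v² z` is a bound on `z` when `1 / v` is controlled. -/
lemma norm_le_of_speed {v Λ c : ℝ} {z : ℂ} (hv : 0 < v) (hΛ : 1 / v ≤ Λ)
    (h : ‖((v ^ 2 : ℝ) : ℂ) * z‖ ≤ c) : ‖z‖ ≤ Λ ^ 2 * c := by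
  rw [norm_mul, Complex.norm_real, Real.norm_eq_abs, abs_of_pos (by positivity)] at h
  have h1 : ‖z‖ = (1 / v) ^ 2 * (v ^ 2 * ‖z‖) := by field_simp
  have h2 : 0 ≤ c := le_trans (by positivity) h
  rw [h1]
  exact mul_le_mul (pow_le_pow_left₀ (by positivity) hΛ 2) h (by positivity) (by positivity)

/-- The weights of the Bloch sum are bounded for each fixed contrast, which is all that its
termwise differentiation needs. -/
lemma norm_weight_le {G : Geometry N} (hP : P.HighContrast Λ δ) (hδ : 0 < δ) (α : ℝ) (m : ℤ)
    (i : Fin N) : ‖G.phase α m * (P.ρr m i / P.contrast m : ℝ)‖ ≤ P.κr * Λ ^ 2 * (Λ / δ) := by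
  have hΛ := hP.nonneg
  have hε := P.contrast_pos m
  have hρ := P.ρr_pos m i
  have hκ := P.κr_pos
  rw [norm_mul, Geometry.norm_phase, one_mul, Complex.norm_real, Real.norm_eq_abs,
    abs_of_pos (div_pos hρ hε), div_eq_mul_inv]
  have h1 : P.ρr m i = P.κr * (1 / P.vr m i) ^ 2 := by
    rw [Material.vr, div_pow, Real.sq_sqrt (by positivity)]
    field_simp
  have h2 : (P.contrast m)⁻¹ ≤ Λ / δ := by
    rw [inv_eq_one_div, div_le_div_iff₀ hε hδ, one_mul]
    exact hP.le_contrast m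
  have h3 : (1 / P.vr m i) ^ 2 ≤ Λ ^ 2 :=
    pow_le_pow_left₀ (one_div_pos.2 (P.vr_pos m i)).le (hP.inside m i) 2
  rw [h1]
  exact mul_le_mul (mul_le_mul_of_nonneg_left h3 hκ.le) h2 (inv_pos.2 hε).le (by positivity)

end Material

namespace Extension

variable {N : ℕ} {G : Geometry N} {P : Material N} {u : ℝ → ℝ → ℂ} {E R : ℤ → ℝ × ℝ → ℂ}
  {Λ δ : ℝ}

lemma mode_eq (X : Extension G u E R) (m : ℤ) (i : Fin N) (t : ℝ) :
    G.mode u m i t = mean (fun x => R (idx m i) (x, t)) (G.lo (idx m i)) (G.hi (idx m i)) := by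
  have hlt := G.lo_lt_hi (idx m i)
  have h1 : ∫ x in (G.lo (idx m i))..(G.hi (idx m i)), u x t =
      ∫ x in (G.lo (idx m i))..(G.hi (idx m i)), R (idx m i) (x, t) := by
    refine intervalIntegral.integral_congr_ae ?_
    have h2 : ∀ᵐ x : ℝ, x ≠ G.hi (idx m i) := by simp [ae_iff, measure_singleton]
    filter_upwards [h2] with x hx hm
    rw [Set.uIoc_of_le hlt.le] at hm
    exact X.eq_resonator _ x ⟨hm.1, lt_of_le_of_ne hm.2 hx⟩ t
  rw [Geometry.mode, h1, G.len_eq m, mean, Geometry.resLen]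

/-- The transmission conditions, in terms of the extensions. -/
lemma snapshot (X : Extension G u E R) (hu : P.IsSolution G u) (hP : P.HighContrast Λ δ) (t : ℝ) :
    Snapshot G Λ δ (fun k => 1 / P.s (G.posOf k) t) (fun k => P.contrast (G.cellOf k))
      (fun k x => E k (x, t)) (fun k x => R k (x, t)) := by
  have hE := fun k => contDiff_slice (X.contDiff_gap k) t
  have hR := fun k => contDiff_slice (X.contDiff_resonator k) t
  have hE0 := fun k => (hE k).continuous
  have hR0 := fun k => (hR k).continuous
  have hE1 := fun k => (contDiff_one_deriv (hE k)).continuous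
  have hR1 := fun k => (contDiff_one_deriv (hR k)).continuous
  have gE : ∀ k, ∀ y ∈ Set.Ioo (G.hi k) (G.lo (k + 1)), u y t = E k (y, t) :=
    fun k y hy => X.eq_gap k y hy t
  have gR : ∀ k, ∀ y ∈ Set.Ioo (G.lo k) (G.hi k), u y t = R k (y, t) :=
    fun k y hy => X.eq_resonator k y hy t
  have gE1 := fun k => deriv_eq_of_eqOn_Ioo (gE k)
  have gR1 := fun k => deriv_eq_of_eqOn_Ioo (gR k)
  refine ⟨hE, hR, fun k => one_div_ne_zero (P.s_ne _ t), fun k => hP.inv_source_le _ t,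
    fun k => by simpa using hP.source_le _ t, fun k => P.contrast_pos _,
    fun k => hP.contrast_le _, fun k => ?_, fun k => ?_, fun k => ?_, fun k => ?_⟩
  · have h := hu.value_lo (G.cellOf (k + 1)) (G.posOf (k + 1)) t
    rw [G.idx_cellOf_posOf, traceLeft_eq (G.hi_lt_lo k) (gE k) (hE0 k).continuousAt,
      traceRight_eq (G.lo_lt_hi (k + 1)) (gR (k + 1)) (hR0 (k + 1)).continuousAt] at h
    exact h
  · have h := hu.value_hi (G.cellOf k) (G.posOf k) t
    rw [G.idx_cellOf_posOf, traceRight_eq (G.hi_lt_lo k) (gE k) (hE0 k).continuousAt,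
      traceLeft_eq (G.lo_lt_hi k) (gR k) (hR0 k).continuousAt] at h
    exact h
  · have h := hu.flux_lo (G.cellOf (k + 1)) (G.posOf (k + 1)) t
    rw [G.idx_cellOf_posOf, traceLeft_eq (G.hi_lt_lo k) (gE1 k) (hE1 k).continuousAt,
      traceRight_eq (G.lo_lt_hi (k + 1)) (gR1 (k + 1)) (hR1 (k + 1)).continuousAt] at h
    exact h
  · have h := hu.flux_hi (G.cellOf k) (G.posOf k) t
    rw [G.idx_cellOf_posOf, traceRight_eq (G.hi_lt_lo k) (gE1 k) (hE1 k).continuousAt,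
      traceLeft_eq (G.lo_lt_hi k) (gR1 k) (hR1 k).continuousAt] at h
    exact h

lemma deriv_eq_dt (X : Extension G u E R) {k : ℤ} {x : ℝ} (hx : x ∈ G.resonator k) :
    deriv (fun τ => u x τ) = fun τ => dt (R k) (x, τ) := by
  rw [show (fun τ => u x τ) = fun τ => R k (x, τ) from funext (X.eq_resonator k x hx)]
  exact funext fun τ => (hasDerivAt_dt ((X.contDiff_resonator k).of_le (by norm_num)) x τ).deriv

lemma iteratedDeriv_two_eq_dt (X : Extension G u E R) {k : ℤ} {x : ℝ} (hx : x ∈ G.resonator k)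
    (t : ℝ) : iteratedDeriv 2 (fun τ => u x τ) t = dt (dt (R k)) (x, t) := by
  rw [iteratedDeriv_two, X.deriv_eq_dt hx]
  exact (hasDerivAt_dt (contDiff_dt (X.contDiff_resonator k)) x t).deriv

/-- The wave equation in a resonator, with the time derivative expanded. -/
lemma wave_resonator (X : Extension G u E R) (hu : P.IsSolution G u) (m : ℤ) (i : Fin N)
    {x : ℝ} (hx : x ∈ G.resonator (idx m i)) (t : ℝ) :
    ((deriv (P.invκ i) t : ℝ) : ℂ) * dt (R (idx m i)) (x, t) +
      P.invκ i t * dt (dt (R (idx m i))) (x, t) =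
    (P.vr m i ^ 2 : ℝ) * iteratedDeriv 2 (fun y => R (idx m i) (y, t)) x := by
  have h := hu.wave_resonator m i x hx t
  rw [Set.EqOn.iteratedDeriv_of_isOpen (fun y hy => X.eq_resonator _ y hy t) isOpen_Ioo 2 hx,
    X.deriv_eq_dt hx] at h
  have hd := (((P.differentiable_invκ i t).hasDerivAt.ofReal_comp).mul
    (hasDerivAt_dt (contDiff_dt (X.contDiff_resonator (idx m i))) x t)).deriv
  exact hd.symm.trans (sub_eq_zero.1 h)

/-- The wave equations turn the bounds on time derivatives into bounds on the second derivative
in space. -/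
lemma snapshotBound (X : Extension G u E R) (hu : P.IsSolution G u) (hP : P.HighContrast Λ δ)
    {t b d : ℝ} {k : ℤ} (hb : 0 ≤ b) (hd : 0 ≤ d)
    (h : ∀ x ∈ G.resonator k ∪ G.gap k, ‖u x t‖ ≤ b ∧ ‖deriv (fun τ => u x τ) t‖ ≤ b * d ∧
      ‖iteratedDeriv 2 (fun τ => u x τ) t‖ ≤ b * d) :
    SnapshotBound G (fun k x => E k (x, t)) (fun k x => R k (x, t))
      (Λ ^ 2 + 2 * Λ ^ 3) b d k := by
  have hΛ := hP.nonneg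
  refine ⟨fun x hx => ?_, fun x hx => ?_, fun x hx => ?_⟩
  · rw [← X.eq_gap k x hx t]
    exact (h x (Or.inr hx)).1
  · have h1 := sub_eq_zero.1 (hu.wave_gap k x hx t)
    rw [Set.EqOn.iteratedDeriv_of_isOpen (fun y hy => X.eq_gap _ y hy t) isOpen_Ioo 2 hx] at h1
    have h2 := (h x (Or.inr hx)).2.2
    rw [h1] at h2
    refine (norm_le_of_speed P.v₀_pos hP.background h2).trans ?_
    have : 0 ≤ 2 * Λ ^ 3 * (b * d) := by positivity
    linarith
  · obtain ⟨m, i, rfl⟩ : ∃ m i, k = idx m i := ⟨_, _, (G.idx_cellOf_posOf k).symm⟩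
    obtain ⟨-, h1, h2⟩ := h x (Or.inl hx)
    rw [X.deriv_eq_dt hx] at h1
    rw [X.iteratedDeriv_two_eq_dt hx] at h2
    have h3 : ‖((P.vr m i ^ 2 : ℝ) : ℂ) * iteratedDeriv 2 (fun y => R (idx m i) (y, t)) x‖ ≤
        Λ * (b * d) + Λ * (b * d) := by
      rw [← X.wave_resonator hu m i hx t]
      refine (norm_add_le _ _).trans (add_le_add ?_ ?_)
      · rw [norm_mul, Complex.norm_real]
        exact mul_le_mul (hP.deriv_invκ_le i t) h1 (norm_nonneg _) hΛ
      · rw [norm_mul, Complex.norm_real]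
        exact mul_le_mul (hP.invκ_le i t) h2 (norm_nonneg _) hΛ
    refine (norm_le_of_speed (P.vr_pos m i) (hP.inside m i) h3).trans ?_
    have : 0 ≤ Λ ^ 2 * (b * d) := by positivity
    linarith

/-- The wave equation integrated over a resonator: the momentum of the mean changes at the rate
of the flux through the boundary. -/
lemma momentum_balance (X : Extension G u E R) (hu : P.IsSolution G u) (m : ℤ) (i : Fin N)
    (t : ℝ) :
    ((deriv (P.invκ i) t : ℝ) : ℂ) *
        mean (fun x => dt (R (idx m i)) (x, t)) (G.lo (idx m i)) (G.hi (idx m i)) +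
      P.invκ i t *
        mean (fun x => dt (dt (R (idx m i))) (x, t)) (G.lo (idx m i)) (G.hi (idx m i)) =
    (P.vr m i ^ 2 : ℝ) * ((G.len i)⁻¹ : ℝ) *
      (deriv (fun y => R (idx m i) (y, t)) (G.hi (idx m i)) -
        deriv (fun y => R (idx m i) (y, t)) (G.lo (idx m i))) := by
  have hc := contDiff_dt (X.contDiff_resonator (idx m i))
  rw [G.len_eq m, Geometry.resLen, ← mean_eq_of_eq_iteratedDeriv_two
    (contDiff_slice (X.contDiff_resonator (idx m i)) t) (G.lo_lt_hi (idx m i)) _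
    (fun x hx => X.wave_resonator hu m i hx t), mean, mean, mean,
    intervalIntegral.integral_add
      (((continuous_slice hc.continuous t).intervalIntegrable _ _).const_mul _)
      (((continuous_slice (continuous_dt hc) t).intervalIntegrable _ _).const_mul _),
    intervalIntegral.integral_const_mul, intervalIntegral.integral_const_mul]
  ring

/-- Means over a resonator of the first two time derivatives inherit the bounds on the field. -/
lemma norm_means_le (X : Extension G u E R) {t b d : ℝ} {k : ℤ}
    (h : ∀ x ∈ G.resonator k ∪ G.gap k, ‖u x t‖ ≤ b ∧ ‖deriv (fun τ => u x τ) t‖ ≤ b * d ∧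
      ‖iteratedDeriv 2 (fun τ => u x τ) t‖ ≤ b * d) :
    ‖mean (fun x => R k (x, t)) (G.lo k) (G.hi k)‖ ≤ b ∧
    ‖mean (fun x => dt (R k) (x, t)) (G.lo k) (G.hi k)‖ ≤ b * d ∧
    ‖mean (fun x => dt (dt (R k)) (x, t)) (G.lo k) (G.hi k)‖ ≤ b * d := by
  have hR := X.contDiff_resonator k
  refine ⟨norm_mean_le (continuous_slice hR.continuous t) (G.lo_lt_hi k) fun x hx => ?_,
    norm_mean_le (continuous_slice (contDiff_dt hR).continuous t) (G.lo_lt_hi k) fun x hx => ?_,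
    norm_mean_le (continuous_slice (continuous_dt (contDiff_dt hR)) t) (G.lo_lt_hi k)
      fun x hx => ?_⟩
  · rw [← X.eq_resonator k x hx t]
    exact (h x (Or.inl hx)).1
  · have := (h x (Or.inl hx)).2.1
    rwa [X.deriv_eq_dt hx] at this
  · have := (h x (Or.inl hx)).2.2
    rwa [X.iteratedDeriv_two_eq_dt hx] at this

/-- The weighted Bloch sum and its momentum are differentiable, and the derivative of the momentum
is the Bloch sum of the fluxes out of the resonators. -/
lemma hasDerivAt_momentum (X : Extension G u E R) (hu : P.IsSolution G u)
    (hP : P.HighContrast Λ δ) (hδ : 0 < δ) {J : Set ℝ} (hJ : IsOpen J) {b : ℤ → ℝ} {d : ℝ}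
    (hb : Summable b) (α : ℝ) (i : Fin N)
    (h : ∀ m, ∀ x ∈ G.resonator (idx m i) ∪ G.gap (idx m i), ∀ t ∈ J, ‖u x t‖ ≤ b m ∧
      ‖deriv (fun τ => u x τ) t‖ ≤ b m * d ∧ ‖iteratedDeriv 2 (fun τ => u x τ) t‖ ≤ b m * d)
    {t : ℝ} (ht : t ∈ J) :
    Summable (fun m : ℤ => G.mode u m i t * (G.phase α m * (P.ρr m i / P.contrast m : ℝ))) ∧
    DifferentiableAt ℝ (P.weightedBloch G u α i) t ∧
    ∃ D, HasDerivAt (P.momentum G u α i) D t ∧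
      HasSum (fun m => (P.vr m i ^ 2 : ℝ) * ((G.len i)⁻¹ : ℝ) *
        (deriv (fun y => R (idx m i) (y, t)) (G.hi (idx m i)) -
          deriv (fun y => R (idx m i) (y, t)) (G.lo (idx m i))) *
        (G.phase α m * (P.ρr m i / P.contrast m : ℝ))) D := by
  have hw := fun m => norm_weight_le (G := G) hP hδ α m i
  set w : ℤ → ℂ := fun m => G.phase α m * (P.ρr m i / P.contrast m : ℝ) with hw_def
  have hbound := fun m t (ht : t ∈ J) => X.norm_means_le (fun x hx => h m x hx t ht)
  set g1 : ℤ → ℝ → ℂ := fun m t =>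
    mean (fun x => dt (R (idx m i)) (x, t)) (G.lo (idx m i)) (G.hi (idx m i)) with hg1
  set g2 : ℤ → ℝ → ℂ := fun m t =>
    mean (fun x => dt (dt (R (idx m i))) (x, t)) (G.lo (idx m i)) (G.hi (idx m i)) with hg2
  have hd0 : ∀ m t, HasDerivAt (G.mode u m i) (g1 m t) t := fun m t => by
    rw [show G.mode u m i = _ from funext (X.mode_eq m i)]
    exact hasDerivAt_mean ((X.contDiff_resonator _).of_le (by norm_num)) _ _ _
  have hd1 : ∀ m t, HasDerivAt (g1 m) (g2 m t) t := fun m t =>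
    hasDerivAt_mean (contDiff_dt (X.contDiff_resonator _)) _ _ _
  have hs0 : ∀ t ∈ J, Summable fun m => G.mode u m i t * w m := fun t ht =>
    summable_mul_of_norm_le hb (fun m => by
      rw [X.mode_eq]; exact (hbound m t ht).1) hw
  have hs1 : ∀ t ∈ J, Summable fun m => g1 m t * w m := fun t ht =>
    summable_mul_of_norm_le (hb.mul_right d) (fun m => (hbound m t ht).2.1) hw
  have hs2 : ∀ t ∈ J, Summable fun m => g2 m t * w m := fun t ht =>
    summable_mul_of_norm_le (hb.mul_right d) (fun m => (hbound m t ht).2.2) hw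
  have hD0 : ∀ t ∈ J, HasDerivAt (P.weightedBloch G u α i) (∑' m, g1 m t * w m) t :=
    fun t ht => hasDerivAt_tsum_mul hJ (hb.mul_right d) hw hd0
      (fun m t ht => (hbound m t ht).2.1) hs0 ht
  have hD1 : HasDerivAt (fun t => ∑' m, g1 m t * w m) (∑' m, g2 m t * w m) t :=
    hasDerivAt_tsum_mul hJ (hb.mul_right d) hw hd1 (fun m t ht => (hbound m t ht).2.2) hs1 ht
  refine ⟨hs0 t ht, (hD0 t ht).differentiableAt, ((deriv (P.invκ i) t : ℝ) : ℂ) *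
    ∑' m, g1 m t * w m + P.invκ i t * ∑' m, g2 m t * w m, ?_, ?_⟩
  · refine (((P.differentiable_invκ i t).hasDerivAt.ofReal_comp).mul hD1).congr_of_eventuallyEq ?_
    filter_upwards [hJ.mem_nhds ht] with τ hτ
    rw [Material.momentum, (hD0 τ hτ).deriv]
    rfl
  · refine (((hs1 t ht).hasSum.mul_left _).add ((hs2 t ht).hasSum.mul_left _)).congr_fun
      fun m => ?_
    rw [← X.momentum_balance hu m i t]
    ring

end Extension

end SpaceTimeDefect

open SpaceTimeDefect in
theorem mainTheorem2 {N : ℕ} (G : SpaceTimeDefect.Geometry N) :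
    (∀ (α : ℝ) (j : Fin N), ∃! V : ℝ → ℂ, G.IsPotential α j V) ∧
    ∀ Λ : ℝ, ∃ C : ℝ, ∀ γ ∈ Set.Ioo (0 : ℝ) 1, ∀ δ ∈ Set.Ioc (0 : ℝ) 1,
      ∀ P : SpaceTimeDefect.Material N, P.HighContrast Λ δ →
      ∀ u : ℝ → ℝ → ℂ, P.IsSolution G u →
      ∀ (A : ℝ) (J : Set ℝ), IsOpen J →
        SpaceTimeDefect.IsLocalisedSubwavelength G δ γ A J u →
      (∀ (m : ℤ) (i : Fin N), ∀ x ∈ G.resonator (SpaceTimeDefect.idx m i), ∀ t ∈ J,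
        ‖u x t - G.mode u m i t‖ ≤ C * A * δ ^ ((1 - γ) / 2)) ∧
      ∀ α ∈ Set.Ioc (-(Real.pi / G.L)) (Real.pi / G.L),
        ∀ V : Fin N → ℝ → ℂ, (∀ j, G.IsPotential α j (V j)) →
        ∀ i : Fin N, ∀ t ∈ J,
          Summable (fun m : ℤ => G.mode u m i t * G.phase α m) ∧
          Summable (fun m : ℤ =>
            G.mode u m i t * (G.phase α m * (P.ρr m i / P.contrast m : ℝ))) ∧
          DifferentiableAt ℝ (P.weightedBloch G u α i) t ∧
          DifferentiableAt ℝ (P.momentum G u α i) t ∧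
          ‖(∑ j, (1 / P.s j t : ℝ) * G.capacitance V i j *
                ∑' m : ℤ, G.mode u m j t * G.phase α m)
              - (-((G.len i / (P.κr * P.s i t) : ℝ) *
                deriv (P.momentum G u α i) t))‖
            ≤ C * A * δ ^ ((1 - γ) / 2) := by
  refine ⟨G.existsUnique_isPotential, fun Λ => ?_⟩
  obtain ⟨B, hB⟩ := G.exists_length_bound
  set K := Λ ^ 2 + 2 * Λ ^ 3 with hK_def
  -- The factor five counts the cells whose sizes are summed in `exists_bound`.
  refine ⟨5 * (oscConst Λ B K + 2 * slopeConst Λ B K), ?_⟩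
  intro γ hγ δ hδ P hP u hu A J hJ hloc
  rcases J.eq_empty_or_nonempty with rfl | hne
  · exact ⟨fun _ _ _ _ _ h => h.elim, fun _ _ _ _ _ _ h => h.elim⟩
  obtain ⟨b, hb0, hb, hbA, hbound⟩ := hloc.exists_bound hδ.1.le hne
  obtain ⟨E, R, X⟩ := hu.exists_extension
  set d := δ ^ ((1 - γ) / 2) with hd_def
  have hd0 : 0 ≤ d := Real.rpow_nonneg hδ.1.le _
  have hd1 : d ≤ 1 := Real.rpow_le_one hδ.1.le hδ.2 (by linarith [hγ.2])
  -- The exponent is less than one, so the contrast is dominated by the error.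
  have hδd : δ ≤ d := by
    conv_lhs => rw [← Real.rpow_one δ]
    exact Real.rpow_le_rpow_of_exponent_ge hδ.1 hδ.2 (by linarith [hγ.1])
  have hΛ := hP.nonneg
  have hK : 0 ≤ K := by positivity
  have hB0 : 0 ≤ B := (G.resLen_pos 0).le.trans (hB 0).2.2
  have hosc : 0 ≤ oscConst Λ B K := by unfold oscConst; positivity
  have hslope : 0 ≤ slopeConst Λ B K := by unfold slopeConst; positivity
  have hSB : ∀ m i k, |k - idx m i| ≤ 1 → ∀ t ∈ J,
      SnapshotBound G (fun k x => E k (x, t)) (fun k x => R k (x, t)) K (b m) d k :=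
    fun m i k hk t ht => X.snapshotBound hu hP (hb0 m) hd0 fun x hx => hbound m i k hk x hx t ht
  have hself : ∀ k : ℤ, |k - k| ≤ 1 := fun k => by simp
  refine ⟨fun m i x hx t ht => ?_, fun α _ V hV i t ht => ?_⟩
  · have h1 := (X.snapshot hu hP t).norm_sub_mean_le hΛ hB hK (hb0 m) hδ.1.le hδd hd1
      (hSB m i _ (hself _) t ht) (Set.Ioo_subset_Icc_self hx)
    rw [← X.mode_eq, ← X.eq_resonator _ x hx t] at h1
    have h2 : b m ≤ 5 * A := (hb.le_tsum m fun n _ => hb0 n).trans hbA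
    refine h1.trans (mul_le_mul_of_nonneg_right ?_ hd0)
    have h3 := mul_le_mul_of_nonneg_left h2 hosc
    have h4 := mul_nonneg hslope ((hb0 m).trans h2)
    linarith
  · obtain ⟨hs, hdiff, D, hD, hsum⟩ := X.hasDerivAt_momentum hu hP hδ.1 hJ hb α i
      (fun m x hx t ht => hbound m i _ (hself _) x hx t ht) ht
    have hmode : ∀ j, Summable fun m => G.mode u m j t * G.phase α m := fun j =>
      summable_mul_of_norm_le hb (fun m => by
        rw [X.mode_eq]
        exact (X.norm_means_le (fun x hx => hbound m j _ (hself _) x hx t ht)).1)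
        (fun m => (Geometry.norm_phase α m).le)
    refine ⟨hmode i, hs, hdiff, hD.differentiableAt, ?_⟩
    have hcap := hasSum_capacitance hV (fun j => P.s j t) (fun m j => G.mode u m j t) hmode i
    rw [hD.deriv]
    have hdiffsum := hcap.sub ((hsum.mul_left ((G.len i / (P.κr * P.s i t) : ℝ) : ℂ)).neg)
    have hterm : ∀ m, ‖G.slopeJump (fun k => (1 / P.s (G.posOf k) t : ℝ) *
          G.mode u (G.cellOf k) (G.posOf k) t) (idx m i) * G.phase α m -
        -((G.len i / (P.κr * P.s i t) : ℝ) * ((P.vr m i ^ 2 : ℝ) * ((G.len i)⁻¹ : ℝ) *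
          (deriv (fun y => R (idx m i) (y, t)) (G.hi (idx m i)) -
            deriv (fun y => R (idx m i) (y, t)) (G.lo (idx m i))) *
          (G.phase α m * (P.ρr m i / P.contrast m : ℝ))))‖ ≤
        2 * slopeConst Λ B K * b m * d := fun m => by
      have h1 := (X.snapshot hu hP t).norm_slopeJump_sub_le hΛ hB hK (hb0 m) hδ.1.le hδd hd1
        (hSB m i (idx m i - 1) (by simp) t ht) (hSB m i _ (hself _) t ht)
        (hSB m i (idx m i + 1) (by simp) t ht)
      have hq : ∀ k, mean (fun x => R k (x, t)) (G.lo k) (G.hi k) =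
          G.mode u (G.cellOf k) (G.posOf k) t := fun k => by
        rw [X.mode_eq, G.idx_cellOf_posOf]
      simp only [hq, G.posOf_idx, G.cellOf_idx] at h1
      -- The phase has modulus one, so it may be attached to the error in the cell.
      have h2 : ∀ z : ℂ, ‖z‖ = ‖z * G.phase α m‖ := fun z => by
        rw [norm_mul, Geometry.norm_phase, mul_one]
      rw [h2] at h1
      refine le_of_eq_of_le (congrArg norm ?_) h1
      generalize G.slopeJump _ _ = z
      have hlen : (G.len i : ℂ) ≠ 0 := by
        rw [G.len_eq 0]; exact_mod_cast (G.resLen_pos _).ne'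
      have hκ : (P.κr : ℂ) ≠ 0 := by exact_mod_cast P.κr_pos.ne'
      have hρ : (P.ρr m i : ℂ) ≠ 0 := by exact_mod_cast (P.ρr_pos m i).ne'
      have hε : (P.contrast m : ℂ) ≠ 0 := by exact_mod_cast (P.contrast_pos m).ne'
      have hs' : (P.s i t : ℂ) ≠ 0 := by exact_mod_cast P.s_ne i t
      rw [Material.vr, Real.sq_sqrt (div_pos P.κr_pos (P.ρr_pos m i)).le]
      push_cast
      field_simp
      ring
    have hfin := tsum_of_norm_bounded ((hb.hasSum.mul_left (2 * slopeConst Λ B K)).mul_right d)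
      hterm
    rw [hdiffsum.tsum_eq] at hfin
    refine hfin.trans (mul_le_mul_of_nonneg_right ?_ hd0)
    have h0 : 0 ≤ ∑' m, b m := tsum_nonneg hb0
    have h3 := mul_le_mul_of_nonneg_left hbA hslope
    have h4 := mul_nonneg hosc (h0.trans hbA)
    linarith
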